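/- **Setting.** Let $G\subset SL(N,\mathbb R)$ be a closed connected subgroup with Lie algebra $\mathfrak g$, let $\Gamma\subset G$ be a lattice (a discrete subgroup such that $X=\Gamma\backslash G$ carries a $G$-invariant Borel probability measure), and let $G$ act on $X$ by $g.(\Gamma h)=\Gamma hg^{-1}$. Let $a\in G$ be of class $\mathscr A$: $a$ is conjugate in $SL(N,\mathbb R)$ to a diagonal matrix, no eigenvalue of $\mathrm{Ad}_a$ on $\mathfrak g$ other than $1$ has absolute value $1$, and no two different eigenvalues of $\mathrm{Ad}_a$ have the same absolute value. Put $T:X\to X$, $T(x)=a.x$. Let $\mathfrak g_0$ be the eigenspace of $\mathrm{Ad}_a$ for the eigenvalue $1$, and let $\mathfrak g_+$ (resp. $\mathfrak g_-$) be the sum of the eigenspaces with eigenvalues of absolute value $>1$ (resp. $<1$). Let $G^+=\{g\in G: a^lga^{-l}\to e \text{ as } l\to-\infty\}$. Fix a basis of $\mathfrak g_+$ and bases of $\mathfrak g_0$, $\mathfrak g_-$ consisting of eigenvectors of $\mathrm{Ad}_a$, and let $B^+_s,B^0_s,B^-_s$ be the open balls of radius $s$ about $0$ for the corresponding sup norms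 of coordinates. A Borel probability measure $\mu$ on $X$ has *local dimension* $\kappa>0$ *in the unstable horospherical direction* if it has compact support and there are $s_0>0$, a finite Borel measure $\lambda$ on $X$ and a constant $C$ such that $$\mu\big(\exp(B_s^-)\exp(B_s^0)\exp(B^+_{\delta\tilde s}+u).x\big)\le C\,\delta^{\kappa}\,\lambda\big(\exp(B_s^-)\exp(B_s^0)\exp(B^+_{\tilde s}+u).x\big)$$ for all $0<\tilde s\le s<s_0$, $u\in B_s^+$ with $B^+_{\tilde s}+u\subset B_s^+$, $0<\delta<1$ and $x\in\mathrm{supp}(\mu)$. **Theorem.** Suppose that $G^+$ is abelian and that $\mathfrak g_+$ is a (nonzero) eigenspace of $\mathrm{Ad}_a$, with eigenvalue of absolute value $e^t$. Let $\mu$ be a Borel probability measure on $X$ which has local dimension $\kappa$ in the unstable horospherical direction for some $\kappa>0$, and let the Radon measure $\rho$ be a limit point, in the weak$^*$ topology (tested against $C_c(X)$), of the sequence $\frac1k\sum_{l=0}^{k-1}T^l_*\mu$, with $\rho(X)>0$. Then $\nu=\rho/\rho(X)$ is a $T$-invariant probability measure and its measure-theoretic entropy satisfies $h_\nu(T)\ge\kappa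 t$. -/

import Mathlib

open Filter Topology MeasureTheory
open scoped ENNReal NNReal CompactlySupported

noncomputable section

namespace HomDyn

/-! ### Entropy of a measure preserving map -/

section Entropy

variable {Ω ι : Type*} [MeasurableSpace Ω]

/-- The entropy `H_ν(P) = ∑_{P ∈ 𝒫} ν(P) (-log ν(P))` of a countable partition `𝒫`. The partition
is given by its labelling `ξ : Ω → ι`; its cells are the non-empty fibres of `ξ` (an empty fibre
contributes `0`). -/
def partitionEntropy (ν : Measure Ω) (ξ : Ω → ι) : ℝ≥0∞ :=
  ∑' c : ι, ENNReal.ofReal (Real.negMulLog (ν.real (ξ ⁻¹' {c})))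

/-- The labelling of the common refinement `⋁_{i < m} T⁻ⁱ 𝒫`: its cells are the non-empty sets
`P₀ ∩ T⁻¹ P₁ ∩ ⋯ ∩ T^{-(m-1)} P_{m-1}`. -/
def itinerary (T : Ω → Ω) (ξ : Ω → ι) (m : ℕ) : Ω → (Fin m → ι) :=
  fun x i => ξ (T^[(i : ℕ)] x)

/-- `h_ν(T, 𝒫) = lim_m (1/m) H_ν(⋁_{i < m} T⁻ⁱ 𝒫)`. For a `T`-invariant probability measure and a
partition of finite entropy the limit exists by subadditivity, hence equals the lower limit. -/
def entropyOfPartition (T : Ω → Ω) (ν : Measure Ω) (ξ : Ω → ι) : ℝ≥0∞ :=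
  liminf (fun m : ℕ => partitionEntropy ν (itinerary T ξ m) / (m : ℝ≥0∞)) atTop

/-- The (Kolmogorov-Sinai) entropy `h_ν(T)`: the supremum of `h_ν(T, 𝒫)` over the finite or
countable measurable partitions `𝒫` with `H_ν(𝒫) < ∞`. -/
def measureEntropy (T : Ω → Ω) (ν : Measure Ω) : ℝ≥0∞ :=
  ⨆ (ξ : Ω → ℕ) (_ : Measurable ξ) (_ : partitionEntropy ν ξ < ∞), entropyOfPartition T ν ξ

end Entropy

/-! ### Averages and weak-* limit points -/

section Averages

variable {X : Type*} [MeasurableSpace X]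

/-- The Cesàro average `(1/k) ∑_{l < k} T^l_* μ`. -/
def cesaroAverage (T : X → X) (μ : Measure X) (k : ℕ) : Measure X :=
  (k : ℝ≥0∞)⁻¹ • ∑ l ∈ Finset.range k, μ.map (T^[l])

/-- `ρ` is a limit point of the sequence `μs` of measures in the weak-* topology, that is, in the
topology of pointwise convergence of the functionals `f ↦ ∫ f dρ` on `C_c(X)`. -/
def IsWeakStarLimitPoint [TopologicalSpace X] (ρ : Measure X) (μs : ℕ → Measure X) : Prop :=
  MapClusterPt (fun f : C_c(X, ℝ) => ∫ x, f x ∂ρ) atTop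
    (fun k : ℕ => fun f : C_c(X, ℝ) => ∫ x, f x ∂(μs k))

end Averages

/-! ### The homogeneous space `Γ \ G` -/

section HomogeneousSpace

variable {G : Type*} [Group G]

/-- The space `X = Γ \ G` of cosets `Γ h`. -/
def CosetSpace (Γ : Subgroup G) : Type _ := Quotient (QuotientGroup.rightRel Γ)

/-- The action `g.(Γ h) = Γ (h g⁻¹)` of `G` on `Γ \ G`. -/
instance (Γ : Subgroup G) : MulAction G (CosetSpace Γ) where
  smul g := Quotient.map (fun h => h * g⁻¹) (by
    intro x y hxy
    have h' : y * x⁻¹ ∈ Γ := QuotientGroup.rightRel_apply.1 hxy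
    refine QuotientGroup.rightRel_apply.2 ?_
    simpa [mul_assoc] using h')
  one_smul := by
    rintro ⟨h⟩
    exact congrArg (Quotient.mk _) (by simp)
  mul_smul := by
    rintro g g' ⟨h⟩
    exact congrArg (Quotient.mk _) (by simp [mul_assoc])

instance [TopologicalSpace G] (Γ : Subgroup G) : TopologicalSpace (CosetSpace Γ) :=
  inferInstanceAs (TopologicalSpace (Quotient _))

instance [TopologicalSpace G] (Γ : Subgroup G) : MeasurableSpace (CosetSpace Γ) :=
  borel _

instance [TopologicalSpace G] (Γ : Subgroup G) : BorelSpace (CosetSpace Γ) :=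
  ⟨rfl⟩

/-- `Γ` is a lattice: it is discrete and `Γ \ G` carries a `G`-invariant Borel probability
measure. -/
def IsLattice [TopologicalSpace G] (Γ : Subgroup G) : Prop :=
  DiscreteTopology Γ ∧
    ∃ m : Measure (CosetSpace Γ), IsProbabilityMeasure m ∧
      ∀ g : G, m.map (fun x => g • x) = m

/-- The unstable horospherical subgroup
`G⁺ = {g : a^l g a^{-l} → e as l → -∞}` of `a`. -/
def unstableHorospherical [TopologicalSpace G] [IsTopologicalGroup G] (a : G) : Subgroup G where
  carrier := {g | Tendsto (fun l : ℤ => a ^ l * g * a ^ (-l)) atBot (𝓝 1)}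
  one_mem' := by simp [tendsto_const_nhds]
  mul_mem' := by
    intro g h hg hh
    have := Tendsto.mul hg hh
    rw [mul_one] at this
    refine this.congr fun l => ?_
    group
  inv_mem' := by
    intro g hg
    have := Tendsto.inv hg
    rw [inv_one] at this
    refine this.congr fun l => ?_
    group

end HomogeneousSpace

/-! ### The Lie algebra of a closed linear group -/

/-- If a curve `c` through `1` has velocity `Z` at time `0`, then `c(1/n)^n → exp Z`. -/
theorem tendsto_pow_exp_of_hasDerivAt {A : Type*} [NormedRing A] [NormedAlgebra ℝ A]
    [CompleteSpace A] {c : ℝ → A} {Z : A} (h0 : c 0 = 1) (hc : HasDerivAt c Z 0) :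
    Tendsto (fun n : ℕ => c ((n : ℝ)⁻¹) ^ n) atTop (𝓝 (NormedSpace.exp Z)) := by
  let _ : NormedAlgebra ℚ A := NormedAlgebra.restrictScalars ℚ ℝ A
  have he : HasStrictFDerivAt (NormedSpace.exp : A → A)
      ((ContinuousLinearEquiv.refl ℝ A : A ≃L[ℝ] A) : A →L[ℝ] A) 0 :=
    hasStrictFDerivAt_exp_zero (𝕂 := ℝ)
  have hL := he.to_localInverse.hasFDerivAt
  have hr := he.eventually_right_inverse
  have hL0 : he.localInverse NormedSpace.exp _ 0 1 = 0 := by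
    simpa using he.localInverse_apply_image
  rw [NormedSpace.exp_zero] at hL hr
  set L := he.localInverse NormedSpace.exp _ 0 with hLdef
  rw [← h0] at hL
  have hd : HasDerivAt (L ∘ c) Z 0 := by
    simpa using hL.comp_hasDerivAt (0 : ℝ) hc
  have hinv : Tendsto (fun n : ℕ => ((n : ℝ)⁻¹)) atTop (𝓝[≠] 0) := by
    refine tendsto_nhdsWithin_iff.2 ⟨tendsto_inv_atTop_nhds_zero_nat, ?_⟩
    filter_upwards [eventually_gt_atTop 0] with n hn
    have : (n : ℝ) ≠ 0 := by positivity
    simpa using this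
  have hs := (hasDerivAt_iff_tendsto_slope.1 hd).comp hinv
  have hs' : Tendsto (fun n : ℕ => n • L (c ((n : ℝ)⁻¹))) atTop (𝓝 Z) := by
    refine hs.congr fun n => ?_
    simp [slope, h0, hL0, Nat.cast_smul_eq_nsmul]
  have hcont : Tendsto (fun n : ℕ => NormedSpace.exp (n • L (c ((n : ℝ)⁻¹)))) atTop
      (𝓝 (NormedSpace.exp Z)) :=
    (NormedSpace.exp_continuous.tendsto Z).comp hs'
  have hcn : Tendsto (fun n : ℕ => c ((n : ℝ)⁻¹)) atTop (𝓝 1) := by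
    have := hc.continuousAt.tendsto.comp (hinv.mono_right nhdsWithin_le_nhds)
    rwa [h0] at this
  refine hcont.congr' ?_
  filter_upwards [hcn.eventually hr] with n hn
  rw [NormedSpace.exp_nsmul, hn]

/-- The Lie product formula. -/
theorem tendsto_exp_mul_exp_pow {A : Type*} [NormedRing A] [NormedAlgebra ℝ A]
    [CompleteSpace A] (X Y : A) :
    Tendsto (fun n : ℕ => (NormedSpace.exp ((n : ℝ)⁻¹ • X) * NormedSpace.exp ((n : ℝ)⁻¹ • Y)) ^ n)
      atTop (𝓝 (NormedSpace.exp (X + Y))) := by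
  have h1 := hasDerivAt_exp_smul_const (𝕂 := ℝ) X 0
  have h2 := hasDerivAt_exp_smul_const (𝕂 := ℝ) Y 0
  have h3 : HasDerivAt ((fun s : ℝ => NormedSpace.exp (s • X)) *
      (fun s : ℝ => NormedSpace.exp (s • Y))) (X + Y) 0 := by
    simpa using h1.mul h2
  exact tendsto_pow_exp_of_hasDerivAt (by simp) h3

theorem matrix_tendsto_exp_mul_exp_pow {N : ℕ} (X Y : Matrix (Fin N) (Fin N) ℝ) :
    Tendsto (fun n : ℕ => (NormedSpace.exp ((n : ℝ)⁻¹ • X) * NormedSpace.exp ((n : ℝ)⁻¹ • Y)) ^ n)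
      atTop (𝓝 (NormedSpace.exp (X + Y))) := by
  let _ := Matrix.linftyOpNormedRing (n := Fin N) (α := ℝ)
  let _ := Matrix.linftyOpNormedAlgebra (n := Fin N) (R := ℝ) (α := ℝ)
  exact tendsto_exp_mul_exp_pow X Y

section LieAlgebra

variable {N : ℕ} {G : Subgroup (Matrix.SpecialLinearGroup (Fin N) ℝ)}

/-- A closed linear group is closed in the space of all matrices. -/
theorem isClosed_image_val (hG : IsClosed (G : Set (Matrix.SpecialLinearGroup (Fin N) ℝ))) :
    IsClosed {M : Matrix (Fin N) (Fin N) ℝ |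
      ∃ g ∈ G, (g : Matrix (Fin N) (Fin N) ℝ) = M} :=
  Matrix.SpecialLinearGroup.isClosedEmbedding_val.isClosedMap _ hG

/-- The Lie algebra `𝔤 = {X : exp(sX) ∈ G for all real s}` of a closed subgroup `G` of
`SL(N, ℝ)`. -/
def lieAlg (hG : IsClosed (G : Set (Matrix.SpecialLinearGroup (Fin N) ℝ))) :
    Submodule ℝ (Matrix (Fin N) (Fin N) ℝ) where
  carrier := {X | ∀ s : ℝ, ∃ g ∈ G,
    (g : Matrix (Fin N) (Fin N) ℝ) = NormedSpace.exp (s • X)}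
  zero_mem' := fun s => ⟨1, G.one_mem, by simp⟩
  smul_mem' := fun c X hX s => by simpa [smul_smul] using hX (s * c)
  add_mem' := by
    intro X Y hX hY s
    rw [smul_add]
    refine (isClosed_image_val hG).mem_of_tendsto
      (matrix_tendsto_exp_mul_exp_pow (s • X) (s • Y)) (Eventually.of_forall fun n => ?_)
    obtain ⟨g, hg, hgX⟩ := hX ((n : ℝ)⁻¹ * s)
    obtain ⟨h, hh, hhY⟩ := hY ((n : ℝ)⁻¹ * s)
    refine ⟨(g * h) ^ n, G.pow_mem (G.mul_mem hg hh) n, ?_⟩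
    simp [hgX, hhY, smul_smul]

variable (hG : IsClosed (G : Set (Matrix.SpecialLinearGroup (Fin N) ℝ)))

/-- The exponential map `𝔤 → G`. -/
def expG (x : lieAlg hG) : G :=
  ⟨⟨NormedSpace.exp (x : Matrix (Fin N) (Fin N) ℝ), by
      obtain ⟨g, -, h⟩ := x.2 1
      rw [one_smul] at h
      rw [← h]
      exact g.2⟩, by
    obtain ⟨g, hg, h⟩ := x.2 1
    rw [one_smul] at h
    have hgx : (⟨NormedSpace.exp (x : Matrix (Fin N) (Fin N) ℝ), by rw [← h]; exact g.2⟩ :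
        Matrix.SpecialLinearGroup (Fin N) ℝ) = g := Subtype.ext h.symm
    exact (congrArg (· ∈ G) hgx).mpr hg⟩

/-- The adjoint action `Ad_a X = a X a⁻¹` of `a ∈ G` on `𝔤`. -/
def Ad (a : G) : Module.End ℝ (lieAlg hG) where
  toFun x := ⟨((a : Matrix.SpecialLinearGroup (Fin N) ℝ) : Matrix (Fin N) (Fin N) ℝ) * x *
      ((a⁻¹ : G) : Matrix.SpecialLinearGroup (Fin N) ℝ), by
    intro s
    obtain ⟨g, hg, h⟩ := x.2 s
    refine ⟨a * g * (a⁻¹ : G), G.mul_mem (G.mul_mem a.2 hg) (a⁻¹).2, ?_⟩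
    have hdet : IsUnit
        ((a : Matrix.SpecialLinearGroup (Fin N) ℝ) : Matrix (Fin N) (Fin N) ℝ).det := by
      simp
    have hinv : (((a⁻¹ : G) : Matrix.SpecialLinearGroup (Fin N) ℝ) :
        Matrix (Fin N) (Fin N) ℝ) =
        ((a : Matrix.SpecialLinearGroup (Fin N) ℝ) : Matrix (Fin N) (Fin N) ℝ)⁻¹ := by
      refine (Matrix.inv_eq_right_inv ?_).symm
      rw [← Matrix.SpecialLinearGroup.coe_mul]
      simp
    have := Matrix.exp_conj
      ((a : Matrix.SpecialLinearGroup (Fin N) ℝ) : Matrix (Fin N) (Fin N) ℝ)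
      (s • (x : Matrix (Fin N) (Fin N) ℝ)) ((Matrix.isUnit_iff_isUnit_det _).2 hdet)
    rw [Matrix.SpecialLinearGroup.coe_mul, Matrix.SpecialLinearGroup.coe_mul, h, hinv, ← this]
    congr 1
    simp⟩
  map_add' x y := Subtype.ext (by simp [mul_add, add_mul])
  map_smul' c x := Subtype.ext (by simp)

/-- `𝔤₊`: the sum of the eigenspaces of `Ad_a` with eigenvalues greater than `1` in absolute
value. -/
def gPlus (a : G) : Submodule ℝ (lieAlg hG) :=
  ⨆ (lam : ℝ) (_ : 1 < |lam|), (Ad hG a).eigenspace lam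

/-- `𝔤₀`: the eigenspace of `Ad_a` for the eigenvalue `1`. -/
def gZero (a : G) : Submodule ℝ (lieAlg hG) :=
  (Ad hG a).eigenspace 1

/-- `𝔤₋`: the sum of the eigenspaces of `Ad_a` with eigenvalues less than `1` in absolute
value. -/
def gMinus (a : G) : Submodule ℝ (lieAlg hG) :=
  ⨆ (lam : ℝ) (_ : |lam| < 1), (Ad hG a).eigenspace lam

/-- `a` is of class `𝒜`: it is conjugate in `SL(N, ℝ)` to a diagonal matrix, `1` is the only
eigenvalue of `Ad_a` of absolute value `1`, and distinct eigenvalues of `Ad_a` have distinct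
absolute values. -/
structure IsClassA (a : G) : Prop where
  semisimple : ∃ (p : Matrix.SpecialLinearGroup (Fin N) ℝ) (d : Fin N → ℝ),
    ((p * a * p⁻¹ : Matrix.SpecialLinearGroup (Fin N) ℝ) : Matrix (Fin N) (Fin N) ℝ) =
      Matrix.diagonal d
  eq_one : ∀ lam : ℝ, (Ad hG a).HasEigenvalue lam → |lam| = 1 → lam = 1
  eq_of_abs_eq : ∀ lam lam' : ℝ, (Ad hG a).HasEigenvalue lam → (Ad hG a).HasEigenvalue lam' →
    |lam| = |lam'| → lam = lam'

/-- The open ball with centre `c` and radius `r` for the sup norm of coordinates in the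
basis `b`. -/
def supBall {V : Type*} [AddCommGroup V] [Module ℝ V] {n : ℕ} (b : Module.Basis (Fin n) ℝ V)
    (c : V) (r : ℝ) : Set V :=
  {z | ‖b.equivFun (z - c)‖ < r}

variable {hG} {a : G} {nm nz np : ℕ}

/-- The set `exp(B⁻_s) exp(B⁰_s) exp(B⁺_r + u) ⊆ G`. -/
def tube (bm : Module.Basis (Fin nm) ℝ (gMinus hG a))
    (b0 : Module.Basis (Fin nz) ℝ (gZero hG a))
    (bp : Module.Basis (Fin np) ℝ (gPlus hG a))
    (s r : ℝ) (u : gPlus hG a) : Set G :=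
  {g | ∃ (x : gMinus hG a) (y : gZero hG a) (z : gPlus hG a),
    x ∈ supBall bm 0 s ∧ y ∈ supBall b0 0 s ∧ z ∈ supBall bp u r ∧
    g = expG hG x * expG hG y * expG hG z}

/-- `μ` has local dimension `κ` in the unstable horospherical direction (with respect to the
given bases of `𝔤₋`, `𝔤₀` and `𝔤₊`): it has compact support, and there are `s₀ > 0`, a finite
measure `lam` and a constant `C` such that
`μ(exp(B⁻_s) exp(B⁰_s) exp(B⁺_{δ s'} + u).x) ≤ C δ^κ lam(exp(B⁻_s) exp(B⁰_s) exp(B⁺_{s'} + u).x)`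
whenever `0 < s' ≤ s < s₀`, `u ∈ B⁺_s`, `B⁺_{s'} + u ⊆ B⁺_s`, `0 < δ < 1` and `x ∈ supp μ`. -/
def HasLocalDimension (bm : Module.Basis (Fin nm) ℝ (gMinus hG a))
    (b0 : Module.Basis (Fin nz) ℝ (gZero hG a))
    (bp : Module.Basis (Fin np) ℝ (gPlus hG a))
    {Γ : Subgroup G} (μ : Measure (CosetSpace Γ)) (κ : ℝ) : Prop :=
  IsCompact μ.support ∧
    ∃ s₀ : ℝ, 0 < s₀ ∧ ∃ lam : Measure (CosetSpace Γ), IsFiniteMeasure lam ∧ ∃ C : ℝ≥0,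
      ∀ (s s' δ : ℝ) (u : gPlus hG a) (x : CosetSpace Γ),
        0 < s' → s' ≤ s → s < s₀ → u ∈ supBall bp 0 s → supBall bp u s' ⊆ supBall bp 0 s →
        0 < δ → δ < 1 → x ∈ μ.support →
        μ ((fun g : G => g • x) '' tube bm b0 bp s (δ * s') u) ≤
          (C : ℝ≥0∞) * ENNReal.ofReal (δ ^ κ) *
            lam ((fun g : G => g • x) '' tube bm b0 bp s s' u)

end LieAlgebra

end HomDyn

end

open HomDyn

/-! ### Entropy from the measure of cylinders -/

/-! The proof bounds the measure of Bowen balls and then counts how many of them cover a cylinder.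
The Bowen ball of order `n` at `z` is `B_n z`, where `B_n` consists of the `g` with `a^k g a^{-k} ∈
U` for all `0 ≤ k ≤ n`.

Decay of Bowen balls (`exists_measure_bowen_le`). For `z` in a compact set and `U` small,
`μ(T^{-l}(B_n z)) ≤ C e^{-κtn}` with `C` independent of `n`, `l` and `z`. The part of `T^{-l}(B_n
z)` in `supp μ` is covered by thin tubes of unstable width about `e^{-t(l+n)}`, centred at a maximal
separated set. The local dimension compares each of them with a tube of width about `e^{-tl}` at the
same centre, gaining `e^{-κtn}`. The wide tubes overlap boundedly often: conjugation by `a^l` keeps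
them within the injectivity radius, so two centres that share a point and lie in the same cell of a
fixed finite cover would be too close to be separated. Summing gives a multiple of the total mass of
the comparison measure. The geometric input is in `exists_conj_tube_subset` and
`exists_mem_tube_of_conj`; both need the unstable expansion to be exactly `e^t` in every direction.

Passage to the limit. The bound is uniform in `l`, so it holds for the averages. Bowen balls are
open, so it passes to `ρ` (`measure_le_of_isOpen`). Normalising costs the factor `ρ(X)⁻¹`.

From decay to entropy (`measureEntropy_ge_of_bowen_le`). Take a compact `Q` with `ν(Qᶜ) ≤ ε`, label
`Qᶜ` by `0` and cut `Q` into small cells. Following an orbit along a word, a visit to `Q` pins down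
the displacement by injectivity, while a visit to `Qᶜ` multiplies the number of Bowen balls by at
most `K`. A cylinder of length `m` thus has measure at most a constant times `K^{#zeros} e^{-κtm}`.
Integrating minus the logarithm gives `h_ν(T) ≥ κt - ε log K`. By `exists_cover_conj_ball`, `K`
depends only on `a`, not on `Q` or `U`, so `ε → 0` finishes the proof. -/

theorem sum_measureReal_itinerary {Ω : Type*} [MeasurableSpace Ω] {T : Ω → Ω} {ν : Measure Ω}
    [IsProbabilityMeasure ν] (hT : Measurable T) {ξ : Ω → ℕ} (hξ : Measurable ξ)
    {R : ℕ} (hR : ∀ x, ξ x < R) (m : ℕ) (z : (Fin m → ℕ) → ℝ) :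
    ∑ w ∈ Fintype.piFinset (fun _ : Fin m => Finset.range R),
      ν.real (itinerary T ξ m ⁻¹' {w}) * z w = ∫ x, z (itinerary T ξ m x) ∂ν := by
  have hm : Measurable (itinerary T ξ m) :=
    measurable_pi_lambda _ fun i => hξ.comp (hT.iterate i)
  set S := Fintype.piFinset (fun _ : Fin m => Finset.range R)
  have hS : ∀ x, itinerary T ξ m x ∈ S := fun x => by simp [S, itinerary, hR]
  have hz : ∀ x, z (itinerary T ξ m x) =
      ∑ w ∈ S, (itinerary T ξ m ⁻¹' {w}).indicator (fun _ => z w) x := by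
    intro x
    rw [Finset.sum_eq_single_of_mem _ (hS x)]
    · simp
    · intro w _ hw
      exact Set.indicator_of_notMem (s := itinerary T ξ m ⁻¹' {w})
        (fun h => hw (Set.mem_singleton_iff.1 h).symm) _
  simp_rw [hz]
  have hms : ∀ w, MeasurableSet (itinerary T ξ m ⁻¹' {w}) := fun w => hm (measurableSet_singleton w)
  rw [integral_finsetSum _ fun w _ => (integrable_const _).indicator (hms w)]
  refine Finset.sum_congr rfl fun w _ => ?_
  rw [integral_indicator_const _ (hms w), smul_eq_mul]

theorem integral_card_zeros {Ω : Type*} [MeasurableSpace Ω] {T : Ω → Ω} {ν : Measure Ω}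
    [IsProbabilityMeasure ν] (hT : MeasurePreserving T ν ν) {ξ : Ω → ℕ} (hξ : Measurable ξ) (m : ℕ) :
    ∫ x, (((Finset.range m).filter fun i => ξ (T^[i] x) = 0).card : ℝ) ∂ν =
      m * ν.real (ξ ⁻¹' {0}) := by
  have h0 : MeasurableSet (ξ ⁻¹' {0}) := hξ (measurableSet_singleton 0)
  have hi : ∀ i, MeasurableSet (T^[i] ⁻¹' (ξ ⁻¹' {0})) := fun i => hT.measurable.iterate i h0
  have : ∀ x, (((Finset.range m).filter fun i => ξ (T^[i] x) = 0).card : ℝ) =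
      ∑ i ∈ Finset.range m, (T^[i] ⁻¹' (ξ ⁻¹' {0})).indicator (fun _ => (1 : ℝ)) x := by
    intro x
    rw [Finset.card_filter]
    push_cast
    exact Finset.sum_congr rfl fun i _ => by simp [Set.indicator]
  simp_rw [this]
  rw [integral_finsetSum _ fun i _ => (integrable_const _).indicator (hi i)]
  have h1 : ∀ i, ν.real (T^[i] ⁻¹' (ξ ⁻¹' {0})) = ν.real (ξ ⁻¹' {0}) := fun i => by
    simp only [Measure.real, (hT.iterate i).measure_preimage h0.nullMeasurableSet]
  simp [integral_indicator_const _ (hi _), h1]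

/-- Entropy is the mean of `-log` of the cylinder measure. The logarithm of the assumed bound is
affine in the number of zeros of the word, whose mean is `m ν(ξ = 0)` by invariance. -/
theorem partitionEntropy_itinerary_ge {Ω : Type*} [MeasurableSpace Ω] {T : Ω → Ω} {ν : Measure Ω}
    [IsProbabilityMeasure ν] (hT : MeasurePreserving T ν ν) {ξ : Ω → ℕ} (hξ : Measurable ξ)
    {R : ℕ} (hR : ∀ x, ξ x < R) {C K θ : ℝ} (hC : 0 < C) (hK : 0 < K) (hθ : 0 < θ) (m : ℕ)
    (h : ∀ v : ℕ → ℕ, ν.real {x | ∀ i < m, ξ (T^[i] x) = v i} ≤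
      C * K ^ ((Finset.range m).filter fun i => v i = 0).card * θ ^ m) :
    ENNReal.ofReal (m * (-Real.log θ - Real.log K * ν.real (ξ ⁻¹' {0})) - Real.log C) ≤
      partitionEntropy ν (itinerary T ξ m) := by
  classical
  set S := Fintype.piFinset (fun _ : Fin m => Finset.range R) with hSdef
  set p : (Fin m → ℕ) → ℝ := fun w => ν.real (itinerary T ξ m ⁻¹' {w}) with hp
  let ext : (Fin m → ℕ) → ℕ → ℕ := fun w i => if hi : i < m then w ⟨i, hi⟩ else 1
  -- Minus the logarithm of the assumed bound for the cylinder of `w`.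
  let z : (Fin m → ℕ) → ℝ := fun w =>
    -Real.log C - Real.log K * (((Finset.range m).filter fun i => ext w i = 0).card : ℝ)
      - m * Real.log θ
  have hpw : ∀ w, p w * z w ≤ Real.negMulLog (p w) := by
    intro w
    have hb := h (ext w)
    have hset : {x | ∀ i < m, ξ (T^[i] x) = ext w i} = itinerary T ξ m ⁻¹' {w} := by
      ext x
      simp only [Set.mem_ofPred_eq, Set.mem_preimage, Set.mem_singleton_iff, funext_iff, itinerary]
      exact ⟨fun hx i => by simpa [ext] using hx i i.2, fun hx i hi => by simpa [ext, hi] using hx ⟨i, hi⟩⟩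
    rw [hset] at hb
    rcases (measureReal_nonneg : 0 ≤ p w).eq_or_lt with h0 | h0
    · have h0' : p w = 0 := h0.symm
      rw [h0']; simp
    · have hl := Real.log_le_log h0 hb
      rw [Real.log_mul (by positivity) (by positivity), Real.log_mul (by positivity) (by positivity),
        Real.log_pow, Real.log_pow] at hl
      rw [Real.negMulLog, neg_mul, ← mul_neg]
      refine mul_le_mul_of_nonneg_left ?_ h0.le
      simp only [z]
      linarith
  have hsum : ∑ w ∈ S, p w * z w =
      m * (-Real.log θ - Real.log K * ν.real (ξ ⁻¹' {0})) - Real.log C := by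
    rw [sum_measureReal_itinerary hT.measurable hξ hR]
    have hzx : ∀ x, z (itinerary T ξ m x) = (-Real.log C - m * Real.log θ) -
        Real.log K * (((Finset.range m).filter fun i => ξ (T^[i] x) = 0).card : ℝ) := by
      intro x
      have : ((Finset.range m).filter fun i => ext (itinerary T ξ m x) i = 0) =
          (Finset.range m).filter fun i => ξ (T^[i] x) = 0 := by
        refine Finset.filter_congr fun i hi => ?_
        simp [ext, itinerary, Finset.mem_range.1 hi]
      simp only [z, this]
      ring
    simp_rw [hzx]
    have hint : Integrable
        (fun x => (((Finset.range m).filter fun i => ξ (T^[i] x) = 0).card : ℝ)) ν := by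
      refine Integrable.of_bound (C := m) ?_ (Eventually.of_forall fun x => ?_)
      · have : (fun x => (((Finset.range m).filter fun i => ξ (T^[i] x) = 0).card : ℝ)) =
            fun x => ∑ i ∈ Finset.range m,
              (T^[i] ⁻¹' (ξ ⁻¹' {0})).indicator (fun _ => (1 : ℝ)) x := by
          funext x
          rw [Finset.card_filter]
          push_cast
          exact Finset.sum_congr rfl fun i _ => by simp [Set.indicator]
        rw [this]
        refine (Finset.measurable_fun_sum _ fun i _ => ?_).aestronglyMeasurable
        exact measurable_const.indicator (hT.measurable.iterate i (hξ (measurableSet_singleton 0)))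
      · rw [Real.norm_natCast]
        exact_mod_cast (Finset.card_filter_le _ _).trans (by simp)
    rw [integral_sub (integrable_const _) (hint.const_mul _), integral_const_mul,
      integral_card_zeros hT hξ]
    simp
    ring
  rw [← hsum]
  calc ENNReal.ofReal (∑ w ∈ S, p w * z w)
      ≤ ENNReal.ofReal (∑ w ∈ S, Real.negMulLog (p w)) :=
        ENNReal.ofReal_le_ofReal (Finset.sum_le_sum fun w _ => hpw w)
    _ = ∑ w ∈ S, ENNReal.ofReal (Real.negMulLog (p w)) :=
        ENNReal.ofReal_sum_of_nonneg fun w _ =>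
          Real.negMulLog_nonneg measureReal_nonneg measureReal_le_one
    _ ≤ _ := ENNReal.sum_le_tsum _

theorem entropyOfPartition_ge {Ω : Type*} [MeasurableSpace Ω] {T : Ω → Ω} {ν : Measure Ω}
    [IsProbabilityMeasure ν] (hT : MeasurePreserving T ν ν) {ξ : Ω → ℕ} (hξ : Measurable ξ)
    {R : ℕ} (hR : ∀ x, ξ x < R) {C K θ : ℝ} (hC : 0 < C) (hK : 0 < K) (hθ : 0 < θ)
    (h : ∀ (m : ℕ) (v : ℕ → ℕ), ν.real {x | ∀ i < m, ξ (T^[i] x) = v i} ≤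
      C * K ^ ((Finset.range m).filter fun i => v i = 0).card * θ ^ m) :
    ENNReal.ofReal (-Real.log θ - Real.log K * ν.real (ξ ⁻¹' {0})) ≤ entropyOfPartition T ν ξ := by
  set c := -Real.log θ - Real.log K * ν.real (ξ ⁻¹' {0})
  have hlim : Tendsto (fun m : ℕ => ENNReal.ofReal (c - Real.log C * (m : ℝ)⁻¹)) atTop
      (𝓝 (ENNReal.ofReal c)) := by
    refine ENNReal.tendsto_ofReal ?_
    simpa using tendsto_const_nhds.sub
      ((tendsto_const_nhds (x := Real.log C)).mul (tendsto_inv_atTop_nhds_zero_nat (𝕜 := ℝ)))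
  rw [← hlim.liminf_eq]
  refine liminf_le_liminf ?_
  filter_upwards [eventually_gt_atTop 0] with m hm
  have hm' : (0 : ℝ) < m := by exact_mod_cast hm
  rw [ENNReal.le_div_iff_mul_le (by simp [hm.ne']) (by simp)]
  refine le_trans (le_of_eq ?_) (partitionEntropy_itinerary_ge hT hξ hR hC hK hθ m (h m))
  rw [← ENNReal.ofReal_natCast m, ← ENNReal.ofReal_mul' hm'.le]
  congr 1
  field_simp
  ring

theorem partitionEntropy_lt_top_of_bounded {Ω : Type*} [MeasurableSpace Ω] {ν : Measure Ω}
    {ξ : Ω → ℕ} {R : ℕ} (hR : ∀ x, ξ x < R) : partitionEntropy ν ξ < ∞ := by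
  rw [partitionEntropy, tsum_eq_sum (s := Finset.range R)]
  · exact ENNReal.sum_lt_top.2 fun _ _ => ENNReal.ofReal_lt_top
  · intro c hc
    have : ξ ⁻¹' {c} = ∅ := by
      ext x
      simp only [Set.mem_preimage, Set.mem_singleton_iff, Set.mem_empty_iff_false, iff_false]
      rintro rfl
      exact hc (Finset.mem_range.2 (hR x))
    simp [this]

/-! ### Cylinders and Bowen sets of a group action -/

/-- The elements of the group whose conjugates by `1, a, …, aⁿ` all lie in `U`. -/
def bowenSet {G : Type*} [Group G] (a : G) (U : Set G) (n : ℕ) : Set G :=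
  {g | ∀ k ≤ n, a ^ k * g * (a ^ k)⁻¹ ∈ U}

/-- A set of the form `A • x₀` (restricted to prescribed symbols at the times `n + 1, …, n + m`),
where `A A⁻¹` is contained in a Bowen set, is covered by few Bowen balls of order `n + m`. -/
theorem measure_orbit_cylinder_le {G X : Type*} [Group G] [MulAction G X] [MeasurableSpace X]
    {ν : Measure X} {a : G} {U V : Set G} {Q : Set X} {ξ : X → ℕ} {K : ℕ} {D : Fin K → Set G}
    {β : ℕ → ℝ≥0∞}
    (hUV : U ⊆ V) (haUV : ∀ g ∈ U, a * g * a⁻¹ ∈ V)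
    (hinj : ∀ z ∈ Q, ∀ g ∈ V, ∀ g' ∈ V, g • z = g' • z → g = g')
    (hD : ∀ g ∈ U, ∃ j, a * g * a⁻¹ ∈ D j)
    (hDU : ∀ j, ∀ g ∈ D j, ∀ g' ∈ D j, g' * g⁻¹ ∈ U)
    (hξQ : ∀ x, ξ x ≠ 0 → x ∈ Q)
    (hξ : ∀ x y, ξ x ≠ 0 → ξ x = ξ y → ∃ u ∈ U, y = u • x)
    (hβ : ∀ n, ∀ z ∈ Q, ν ((fun g : G => g • z) '' bowenSet a U n) ≤ β n)
    (v : ℕ → ℕ) (m : ℕ) : ∀ (n : ℕ) (A : Set G) (x₀ : X), (∀ g ∈ A, g • x₀ ∈ Q) →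
    (∀ g ∈ A, ∀ g' ∈ A, g' * g⁻¹ ∈ bowenSet a U n) →
    ν ((fun g : G => g • x₀) '' {g | g ∈ A ∧ ∀ i, n < i → i ≤ n + m → ξ (a ^ i • g • x₀) = v i}) ≤
      (K : ℝ≥0∞) ^ ((Finset.Ioc n (n + m)).filter fun i => v i = 0).card * β (n + m) := by
  induction m with
  | zero =>
    intro n A x₀ hAQ hA
    rcases A.eq_empty_or_nonempty with rfl | ⟨g₁, hg₁⟩
    · simp
    · simp only [add_zero, Finset.Ioc_self, Finset.filter_empty, Finset.card_empty, pow_zero, one_mul]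
      refine (measure_mono ?_).trans (hβ n _ (hAQ g₁ hg₁))
      rintro _ ⟨g, ⟨hg, -⟩, rfl⟩
      exact ⟨g * g₁⁻¹, hA _ hg₁ _ hg, by simp [mul_smul]⟩
  | succ m ih =>
    intro n A x₀ hAQ hA
    have hIoc : Finset.Ioc n (n + (m + 1)) = insert (n + 1) (Finset.Ioc (n + 1) (n + 1 + m)) := by
      ext i; simp only [Finset.mem_Ioc, Finset.mem_insert]; omega
    have hadd : n + (m + 1) = n + 1 + m := by ring
    have hconj : ∀ (k : ℕ) (h : G), a ^ (k + 1) * h * (a ^ (k + 1))⁻¹ =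
        a * (a ^ k * h * (a ^ k)⁻¹) * a⁻¹ := fun k h => by simp [pow_succ', mul_assoc]
    by_cases hv : v (n + 1) = 0
    · rcases A.eq_empty_or_nonempty with rfl | ⟨g₀, hg₀⟩
      · simp
      have hcard : ((Finset.Ioc n (n + (m + 1))).filter fun i => v i = 0).card =
          ((Finset.Ioc (n + 1) (n + 1 + m)).filter fun i => v i = 0).card + 1 := by
        rw [hIoc, Finset.filter_insert, if_pos hv, Finset.card_insert_of_notMem]
        simp
      -- The displacement is unconstrained at a time spent outside `Q`, so `A` is cut by the
      -- position of `g g₀⁻¹` relative to a base point. The base point cancels in `g' g⁻¹`.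
      let B : Fin K → Set G := fun j =>
        {g | g ∈ A ∧ a ^ (n + 1) * (g * g₀⁻¹) * (a ^ (n + 1))⁻¹ ∈ D j}
      have hB : ∀ j, ∀ g ∈ B j, ∀ g' ∈ B j, g' * g⁻¹ ∈ bowenSet a U (n + 1) := by
        intro j g hg g' hg' k hk
        rcases hk.lt_or_eq with hk | rfl
        · exact hA g hg.1 g' hg'.1 k (by omega)
        · have := hDU j _ hg.2 _ hg'.2
          convert this using 1
          group
      calc _ ≤ ν (⋃ j, (fun g : G => g • x₀) '' {g | g ∈ B j ∧
              ∀ i, n + 1 < i → i ≤ n + 1 + m → ξ (a ^ i • g • x₀) = v i}) := by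
            refine measure_mono ?_
            rintro _ ⟨g, ⟨hg, hgv⟩, rfl⟩
            obtain ⟨j, hj⟩ := hD _ (hA g₀ hg₀ g hg n le_rfl)
            rw [← hconj] at hj
            exact Set.mem_iUnion.2 ⟨j, g, ⟨⟨hg, hj⟩, fun i h1 h2 => hgv i (by omega) (by omega)⟩, rfl⟩
        _ ≤ ∑ j : Fin K, ν ((fun g : G => g • x₀) '' {g | g ∈ B j ∧
              ∀ i, n + 1 < i → i ≤ n + 1 + m → ξ (a ^ i • g • x₀) = v i}) :=
            measure_iUnion_fintype_le _ _
        _ ≤ ∑ _j : Fin K,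
            (K : ℝ≥0∞) ^ ((Finset.Ioc (n + 1) (n + 1 + m)).filter fun i => v i = 0).card *
              β (n + 1 + m) :=
            Finset.sum_le_sum fun j _ => ih (n + 1) (B j) x₀ (fun g hg => hAQ g hg.1) (hB j)
        _ = _ := by
            rw [hcard, hadd]
            simp [pow_succ]
            ring
    · have hcard : ((Finset.Ioc n (n + (m + 1))).filter fun i => v i = 0).card =
          ((Finset.Ioc (n + 1) (n + 1 + m)).filter fun i => v i = 0).card := by
        rw [hIoc, Finset.filter_insert, if_neg hv]
      -- No splitting is needed here. Two points in the same cell differ by some `u ∈ U`; the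
      -- conjugated displacement lies in `V` and moves the same point of `Q` in the same way, so it
      -- equals `u`.
      let B : Set G := {g | g ∈ A ∧ ξ (a ^ (n + 1) • g • x₀) = v (n + 1)}
      have hB : ∀ g ∈ B, ∀ g' ∈ B, g' * g⁻¹ ∈ bowenSet a U (n + 1) := by
        intro g hg g' hg' k hk
        rcases hk.lt_or_eq with hk | rfl
        · exact hA g hg.1 g' hg'.1 k (by omega)
        · have hne : ξ (a ^ (n + 1) • g • x₀) ≠ 0 := hg.2 ▸ hv
          obtain ⟨u, hu, hux⟩ := hξ _ (a ^ (n + 1) • g' • x₀) hne (hg.2.trans hg'.2.symm)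
          have h1 : a ^ (n + 1) * (g' * g⁻¹) * (a ^ (n + 1))⁻¹ ∈ V := by
            rw [hconj]
            exact haUV _ (hA g hg.1 g' hg'.1 n le_rfl)
          have := hinj _ (hξQ _ hne) _ h1 u (hUV hu) (by
            rw [← hux]; simp [mul_smul])
          rw [this]
          exact hu
      rw [hcard, hadd]
      refine (measure_mono ?_).trans (ih (n + 1) B x₀ (fun g hg => hAQ g hg.1) hB)
      rintro _ ⟨g, ⟨hg, hgv⟩, rfl⟩
      exact ⟨g, ⟨⟨hg, hgv _ (by omega) (by omega)⟩, fun i h1 h2 => hgv i (by omega) (by omega)⟩, rfl⟩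

/-- The covering argument must start inside a small cell. Leading zeros are therefore removed by
invariance of `ν`, each at the cost of a factor `K' θ ≥ 1`, until the first nonzero symbol. -/
theorem measure_cylinder_le {G X : Type*} [Group G] [MulAction G X] [MeasurableSpace X]
    {ν : Measure X} [IsProbabilityMeasure ν] {a : G} {U V : Set G} {Q : Set X} {ξ : X → ℕ} {K : ℕ}
    {D : Fin K → Set G} {C θ : ℝ} (hθ : 0 < θ) (hC : 1 ≤ C)
    (hT : MeasurePreserving (fun x : X => a • x) ν ν) (hξm : Measurable ξ)
    (hUV : U ⊆ V) (haUV : ∀ g ∈ U, a * g * a⁻¹ ∈ V)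
    (hinj : ∀ z ∈ Q, ∀ g ∈ V, ∀ g' ∈ V, g • z = g' • z → g = g')
    (hD : ∀ g ∈ U, ∃ j, a * g * a⁻¹ ∈ D j)
    (hDU : ∀ j, ∀ g ∈ D j, ∀ g' ∈ D j, g' * g⁻¹ ∈ U)
    (hξQ : ∀ x, ξ x ≠ 0 → x ∈ Q)
    (hξ : ∀ i ≠ 0, ∃ (q : X) (W : Set G), (∀ g ∈ W, ∀ g' ∈ W, g' * g⁻¹ ∈ U) ∧
      ξ ⁻¹' {i} ⊆ (fun g : G => g • q) '' W)
    (hβ : ∀ n, ∀ z ∈ Q, ν ((fun g : G => g • z) '' bowenSet a U n) ≤ ENNReal.ofReal (C * θ ^ n))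
    {K' : ℝ} (hK' : K ≤ K') (hK1 : 1 ≤ K') (hKθ : 1 ≤ K' * θ) (m : ℕ) :
    ∀ v : ℕ → ℕ, ν.real {x | ∀ i < m, ξ ((fun x : X => a • x)^[i] x) = v i} ≤
      (C * max 1 θ⁻¹) * K' ^ ((Finset.range m).filter fun i => v i = 0).card * θ ^ m := by
  have hit : ∀ (i : ℕ) (x : X), (fun x : X => a • x)^[i] x = a ^ i • x := fun i x => by
    rw [smul_iterate]
  simp_rw [hit]
  have hK0 : (0 : ℝ) < K' := by linarith
  induction m with
  | zero =>
    intro v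
    simp only [not_lt_zero, IsEmpty.forall_iff, implies_true, Set.ofPred_true, Finset.range_zero,
      Finset.filter_empty, Finset.card_empty, pow_zero, mul_one]
    refine measureReal_le_one.trans ?_
    nlinarith [le_max_left 1 θ⁻¹]
  | succ m ih =>
    intro v
    have hcard : ((Finset.range (m + 1)).filter fun i => v i = 0).card =
        ((Finset.range m).filter fun i => v (i + 1) = 0).card + if v 0 = 0 then 1 else 0 := by
      rw [Finset.card_filter, Finset.sum_range_succ', Finset.card_filter]
    rw [hcard]
    by_cases hv : v 0 = 0
    · rw [if_pos hv]
      have hmc : MeasurableSet {x : X | ∀ i < m, ξ (a ^ i • x) = v (i + 1)} := by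
        have : {x : X | ∀ i < m, ξ (a ^ i • x) = v (i + 1)} =
            ⋂ i, ⋂ (_ : i < m), (fun x : X => ξ ((fun x : X => a • x)^[i] x)) ⁻¹' {v (i + 1)} := by
          ext x
          simp [hit]
        rw [this]
        exact MeasurableSet.iInter fun i => MeasurableSet.iInter fun _ =>
          (hξm.comp (hT.measurable.iterate i)) (measurableSet_singleton _)
      have hle : ν.real {x : X | ∀ i < m + 1, ξ (a ^ i • x) = v i} ≤
          ν.real {x : X | ∀ i < m, ξ (a ^ i • x) = v (i + 1)} := by
        have h1 := hT.measure_preimage hmc.nullMeasurableSet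
        rw [Measure.real, Measure.real, ← h1]
        refine ENNReal.toReal_mono (measure_ne_top _ _) (measure_mono fun x hx i hi => ?_)
        have := hx (i + 1) (by omega)
        rwa [pow_succ, mul_smul] at this
      refine (hle.trans (ih fun i => v (i + 1))).trans ?_
      set e := ((Finset.range m).filter fun i => v (i + 1) = 0).card
      have hpos : 0 ≤ (C * max 1 θ⁻¹) * K' ^ e * θ ^ m := by positivity
      calc _ ≤ (C * max 1 θ⁻¹) * K' ^ e * θ ^ m * (K' * θ) := le_mul_of_one_le_right hpos hKθ
        _ = _ := by ring
    · rw [if_neg hv]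
      obtain ⟨q, W, hWU, hWq⟩ := hξ (v 0) hv
      have hξ' : ∀ x y, ξ x ≠ 0 → ξ x = ξ y → ∃ u ∈ U, y = u • x := by
        intro x y hx hxy
        obtain ⟨q, W, hWU, hWq⟩ := hξ (ξ x) hx
        obtain ⟨g, hg, rfl⟩ := hWq (show ξ x = ξ x from rfl)
        obtain ⟨g', hg', rfl⟩ := hWq hxy.symm
        exact ⟨g' * g⁻¹, hWU g hg g' hg', by simp [mul_smul]⟩
      -- Time `0` only provides the starting cell, so a word of length `m + 1` yields Bowen order
      -- `m`. The factor `max 1 θ⁻¹` absorbs the missing power of `θ`.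
      have key := measure_orbit_cylinder_le (ν := ν) (β := fun n => ENNReal.ofReal (C * θ ^ n)) hUV
        haUV hinj hD hDU hξQ hξ' hβ v m 0 {g | g ∈ W ∧ ξ (g • q) = v 0} q
        (fun g hg => hξQ _ (hg.2 ▸ hv)) (by
          intro g hg g' hg' k hk
          obtain rfl : k = 0 := by omega
          simpa using hWU g hg.1 g' hg'.1)
      have hcard' : ((Finset.Ioc 0 (0 + m)).filter fun i => v i = 0).card =
          ((Finset.range m).filter fun i => v (i + 1) = 0).card := by
        have hm : Finset.Ioc 0 (0 + m) =
            (Finset.range m).map ⟨Nat.succ, Nat.succ_injective⟩ := by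
          ext i
          rcases i with _ | i <;> simp
        rw [hm, Finset.card_filter, Finset.sum_map, Finset.card_filter]
        rfl
      rw [hcard', zero_add] at key
      set e := ((Finset.range m).filter fun i => v (i + 1) = 0).card
      have h2 : ν {x : X | ∀ i < m + 1, ξ (a ^ i • x) = v i} ≤
          ENNReal.ofReal (K' ^ e * (C * θ ^ m)) := by
        refine ((measure_mono ?_).trans key).trans ?_
        · intro x hx
          have h0 : ξ x = v 0 := by simpa using hx 0 (by omega)
          obtain ⟨g, hg, rfl⟩ := hWq h0
          exact ⟨g, ⟨⟨hg, h0⟩, fun i _ h2 => hx i (by omega)⟩, rfl⟩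
        · rw [ENNReal.ofReal_mul (p := K' ^ e) (by positivity), ENNReal.ofReal_pow hK0.le]
          gcongr
          rw [← ENNReal.ofReal_natCast]
          exact ENNReal.ofReal_le_ofReal hK'
      refine (ENNReal.toReal_le_of_le_ofReal (by positivity) h2).trans ?_
      have h3 : 1 ≤ max 1 θ⁻¹ * θ := by
        calc (1 : ℝ) = θ⁻¹ * θ := by field_simp
          _ ≤ _ := by gcongr; exact le_max_right _ _
      have hpos : 0 ≤ K' ^ e * (C * θ ^ m) := by positivity
      calc _ ≤ K' ^ e * (C * θ ^ m) * (max 1 θ⁻¹ * θ) := le_mul_of_one_le_right hpos h3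
        _ = _ := by ring

/-! ### The topology of the coset space -/

/-- The projection `G → Γ \ G`. -/
def CosetSpace.mk {G : Type*} [Group G] (Γ : Subgroup G) : G → CosetSpace Γ :=
  Quotient.mk (QuotientGroup.rightRel Γ)

theorem CosetSpace.mk_surjective {G : Type*} [Group G] (Γ : Subgroup G) :
    Function.Surjective (CosetSpace.mk Γ) :=
  Quotient.mk_surjective

theorem CosetSpace.mk_eq_mk_iff {G : Type*} [Group G] (Γ : Subgroup G) {g h : G} :
    CosetSpace.mk Γ g = CosetSpace.mk Γ h ↔ h * g⁻¹ ∈ Γ :=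
  Quotient.eq.trans QuotientGroup.rightRel_apply

section CosetTopology

variable {G : Type*} [Group G] [TopologicalSpace G] [IsTopologicalGroup G] (Γ : Subgroup G)

theorem CosetSpace.isOpenQuotientMap_mk : IsOpenQuotientMap (CosetSpace.mk Γ) := by
  refine ⟨Quotient.mk_surjective, continuous_quot_mk, ?_⟩
  exact isOpenMap_quotient_mk'_mul (Γ := Γ) (T := G)

theorem CosetSpace.t2Space [T2Space G] [DiscreteTopology Γ] : T2Space (CosetSpace Γ) := by
  rw [t2Space_iff_of_isOpenQuotientMap (CosetSpace.isOpenQuotientMap_mk Γ)]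
  have hΓ : IsClosed (Γ : Set G) := Subgroup.isClosed_of_discrete
  have : {q : G × G | CosetSpace.mk Γ q.1 = CosetSpace.mk Γ q.2} =
      (fun q : G × G => q.2 * q.1⁻¹) ⁻¹' (Γ : Set G) := by
    ext q
    exact CosetSpace.mk_eq_mk_iff Γ
  rw [this]
  exact hΓ.preimage (by fun_prop)

theorem CosetSpace.locallyCompactSpace [LocallyCompactSpace G] :
    LocallyCompactSpace (CosetSpace Γ) :=
  (CosetSpace.isOpenQuotientMap_mk Γ).locallyCompactSpace

theorem CosetSpace.secondCountableTopology [SecondCountableTopology G] :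
    SecondCountableTopology (CosetSpace Γ) :=
  (CosetSpace.isOpenQuotientMap_mk Γ).isQuotientMap.secondCountableTopology
    (CosetSpace.isOpenQuotientMap_mk Γ).isOpenMap

theorem CosetSpace.continuous_smul_left (x : CosetSpace Γ) :
    Continuous (fun g : G => g • x) := by
  obtain ⟨h, rfl⟩ := CosetSpace.mk_surjective Γ x
  exact (CosetSpace.isOpenQuotientMap_mk Γ).continuous.comp
    (show Continuous fun g : G => h * g⁻¹ by fun_prop)

theorem CosetSpace.isOpenMap_smul_left (x : CosetSpace Γ) :
    IsOpenMap (fun g : G => g • x) := by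
  obtain ⟨h, rfl⟩ := CosetSpace.mk_surjective Γ x
  exact (CosetSpace.isOpenQuotientMap_mk Γ).isOpenMap.comp
    ((Homeomorph.inv G).trans (Homeomorph.mulLeft h)).isOpenMap

instance CosetSpace.continuousConstSMul : ContinuousConstSMul G (CosetSpace Γ) where
  continuous_const_smul g := by
    refine (CosetSpace.isOpenQuotientMap_mk Γ).isQuotientMap.continuous_iff.2 ?_
    exact (CosetSpace.isOpenQuotientMap_mk Γ).continuous.comp
      (show Continuous fun h : G => h * g⁻¹ by fun_prop)

/-- The injectivity radius is bounded below on compact sets. -/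
theorem CosetSpace.exists_nhds_injective [DiscreteTopology Γ]
    {Q : Set (CosetSpace Γ)} (hQ : IsCompact Q) :
    ∃ V ∈ 𝓝 (1 : G), ∀ z ∈ Q, ∀ g ∈ V, ∀ g' ∈ V, g • z = g' • z → g = g' := by
  obtain ⟨W, hW, hWΓ⟩ : ∃ W ∈ 𝓝 (1 : G), ∀ g ∈ W, g ∈ Γ → g = 1 := by
    obtain ⟨W, hW, hWΓ⟩ := isOpen_induced_iff.1 (isOpen_discrete ({1} : Set Γ))
    have h1 : (1 : Γ) ∈ ((↑) ⁻¹' W : Set Γ) := hWΓ ▸ rfl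
    refine ⟨W, hW.mem_nhds h1, fun g hg hgΓ => ?_⟩
    have : (⟨g, hgΓ⟩ : Γ) ∈ ((↑) ⁻¹' W : Set Γ) := hg
    rw [hWΓ] at this
    exact congrArg Subtype.val this
  have hloc : ∀ x : CosetSpace Γ, ∃ V ∈ 𝓝 (1 : G), ∃ O ∈ 𝓝 x,
      ∀ z ∈ O, ∀ g ∈ V, ∀ g' ∈ V, g • z = g' • z → g = g' := by
    intro x
    obtain ⟨h, rfl⟩ := CosetSpace.mk_surjective Γ x
    -- If `g` and `g'` agree on `Γ k`, then `k g⁻¹ g' k⁻¹ ∈ Γ`. Joint continuity brings it near `1`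
    -- for all `k` close to `h`, where discreteness makes it trivial.
    have hcont : ContinuousAt (fun p : G × G × G => p.1 * p.2.1⁻¹ * p.2.2 * p.1⁻¹) (h, 1, 1) := by
      fun_prop
    have := hcont (show W ∈ 𝓝 (h * 1⁻¹ * 1 * h⁻¹) by simpa using hW)
    rw [Filter.mem_map, nhds_prod_eq, nhds_prod_eq, mem_prod_iff] at this
    obtain ⟨H, hH, P, hP, hHP⟩ := this
    obtain ⟨V, hV, hVP⟩ := mem_prod_self_iff.1 hP
    refine ⟨V, hV, CosetSpace.mk Γ '' H,
      (CosetSpace.isOpenQuotientMap_mk Γ).isOpenMap.image_mem_nhds hH, ?_⟩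
    rintro _ ⟨k, hk, rfl⟩ g hg g' hg' he
    have he' : CosetSpace.mk Γ (k * g'⁻¹) = CosetSpace.mk Γ (k * g⁻¹) := he.symm
    have hmem := (CosetSpace.mk_eq_mk_iff Γ).1 he'
    have h1 : k * g⁻¹ * g' * k⁻¹ ∈ W := hHP (show (k, g, g') ∈ H ×ˢ P from ⟨hk, hVP ⟨hg, hg'⟩⟩)
    have h2 := hWΓ _ h1 (by simpa [mul_assoc] using hmem)
    have h3 : k * (g⁻¹ * g') * k⁻¹ = 1 := by simpa [mul_assoc] using h2
    exact inv_mul_eq_one.1 (conj_eq_one_iff.1 h3)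
  choose V hV O hO hVO using hloc
  obtain ⟨t, -, ht⟩ := hQ.elim_nhds_subcover O fun x _ => hO x
  refine ⟨⋂ x ∈ t, V x, (Filter.biInter_finset_mem t).2 fun x _ => hV x, ?_⟩
  intro z hz g hg g' hg' he
  obtain ⟨x, hx, hzx⟩ := Set.mem_iUnion₂.1 (ht hz)
  exact hVO x z hzx g (Set.mem_iInter₂.1 hg x hx) g' (Set.mem_iInter₂.1 hg' x hx) he

end CosetTopology

/-- A compact set is covered by finitely many sets which are small in the sense of the group. -/
theorem exists_finite_labelling {G X : Type*} [Group G] [TopologicalSpace G] [IsTopologicalGroup G]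
    [TopologicalSpace X] [Nonempty X] [MulAction G X] [MeasurableSpace X] [BorelSpace X]
    (hop : ∀ x : X, IsOpenMap (fun g : G => g • x)) {Q : Set X} (hQ : IsCompact Q)
    (hQm : MeasurableSet Q) {U : Set G} (hU : U ∈ 𝓝 1) :
    ∃ (ξ : X → ℕ) (R : ℕ), Measurable ξ ∧ (∀ x, ξ x < R) ∧ (∀ x, ξ x ≠ 0 ↔ x ∈ Q) ∧
      ∀ i ≠ 0, ∃ (q : X) (W : Set G), (∀ g ∈ W, ∀ g' ∈ W, g' * g⁻¹ ∈ U) ∧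
        ξ ⁻¹' {i} ⊆ (fun g : G => g • q) '' W := by
  classical
  obtain ⟨W, hWo, hW1, hWU⟩ : ∃ W : Set G, IsOpen W ∧ (1 : G) ∈ W ∧
      ∀ g ∈ W, ∀ g' ∈ W, g' * g⁻¹ ∈ U := by
    have hcont : ContinuousAt (fun p : G × G => p.2 * p.1⁻¹) (1, 1) := by fun_prop
    have := hcont (show U ∈ 𝓝 ((1 : G) * 1⁻¹) by simpa using hU)
    rw [Filter.mem_map, nhds_prod_eq] at this
    obtain ⟨W, hW, hWP⟩ := mem_prod_self_iff.1 this
    obtain ⟨W', hW'W, hW'o, hW'1⟩ := mem_nhds_iff.1 hW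
    exact ⟨W', hW'o, hW'1, fun g hg g' hg' => hWP (show (g, g') ∈ W ×ˢ W from ⟨hW'W hg, hW'W hg'⟩)⟩
  have hOo : ∀ x : X, IsOpen ((fun g : G => g • x) '' W) := fun x => hop x _ hWo
  obtain ⟨t, -, ht⟩ := hQ.elim_nhds_subcover (fun x => (fun g : G => g • x) '' W)
    fun x _ => (hOo x).mem_nhds ⟨1, hW1, one_smul _ _⟩
  let e := t.equivFin
  let P : X → ℕ → Prop := fun x i => ∃ h : i < t.card, x ∈ (fun g : G => g • (e.symm ⟨i, h⟩ : X)) '' W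
  have hP : ∀ x ∈ Q, ∃ i, P x i := by
    intro x hx
    obtain ⟨y, hy, hxy⟩ := Set.mem_iUnion₂.1 (ht hx)
    exact ⟨e ⟨y, hy⟩, (e ⟨y, hy⟩).2, by simpa using hxy⟩
  have hPm : ∀ i, MeasurableSet {x | P x i} := by
    intro i
    by_cases h : i < t.card
    · have : {x | P x i} = (fun g : G => g • (e.symm ⟨i, h⟩ : X)) '' W := by
        ext x
        simp only [P, Set.mem_ofPred_eq]
        exact ⟨fun ⟨_, h⟩ => h, fun hx => ⟨h, hx⟩⟩
      rw [this]
      exact (hOo _).measurableSet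
    · have : {x | P x i} = ∅ := by
        ext x
        simp [P, h]
      rw [this]
      exact MeasurableSet.empty
  -- The first covering set that contains `x`, shifted by one so that `0` is reserved for the
  -- complement of `Q`.
  let ξ : X → ℕ := fun x => if hx : x ∈ Q then Nat.find (hP x hx) + 1 else 0
  have hξ1 : ∀ x i, ξ x = i + 1 → P x i := by
    intro x i hx
    by_cases hxQ : x ∈ Q
    · simp only [ξ, hxQ, dif_pos, Nat.add_right_cancel_iff] at hx
      rw [← hx]
      exact Nat.find_spec (hP x hxQ)
    · simp [ξ, hxQ] at hx
  refine ⟨ξ, t.card + 1, ?_, ?_, ?_, ?_⟩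
  · refine measurable_to_countable' fun i => ?_
    rcases i with _ | i
    · have : ξ ⁻¹' {0} = Qᶜ := by
        ext x
        by_cases hx : x ∈ Q <;> simp [ξ, hx]
      rw [this]
      exact hQm.compl
    · have : ξ ⁻¹' {i + 1} = Q ∩ ({x | P x i} ∩ ⋂ j, ⋂ (_ : j < i), {x | P x j}ᶜ) := by
        ext x
        by_cases hx : x ∈ Q
        · simp only [Set.mem_preimage, ξ, hx, dif_pos, Set.mem_singleton_iff,
            Nat.add_right_cancel_iff, Nat.find_eq_iff]
          simp [hx]
        · simp [ξ, hx]
      rw [this]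
      exact hQm.inter ((hPm i).inter
        (MeasurableSet.iInter fun j => MeasurableSet.iInter fun _ => (hPm j).compl))
  · intro x
    rcases hx : ξ x with _ | i
    · omega
    · obtain ⟨h, -⟩ := hξ1 x i hx
      omega
  · intro x
    by_cases hx : x ∈ Q <;> simp [ξ, hx]
  · intro i hi
    obtain ⟨i, rfl⟩ := Nat.exists_eq_succ_of_ne_zero hi
    by_cases h : i < t.card
    · exact ⟨e.symm ⟨i, h⟩, W, hWU, fun x hx => (hξ1 x i hx).2⟩
    · by_cases hne : ∃ x, ξ x = i + 1
      · obtain ⟨x, hx⟩ := hne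
        exact absurd (hξ1 x i hx).1 h
      · exact ⟨Classical.arbitrary X, W, hWU, fun y hy => absurd ⟨y, hy⟩ hne⟩

/-! ### Weak-* limit points of averages -/

section WeakStar

variable {X : Type*} [TopologicalSpace X] [MeasurableSpace X]

theorem HomDyn.IsWeakStarLimitPoint.exists_ultrafilter {ρ : Measure X} {μs : ℕ → Measure X}
    (h : IsWeakStarLimitPoint ρ μs) : ∃ F : Ultrafilter ℕ, (F : Filter ℕ) ≤ atTop ∧
      ∀ f : C_c(X, ℝ), Tendsto (fun k => ∫ x, f x ∂(μs k)) F (𝓝 (∫ x, f x ∂ρ)) := by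
  obtain ⟨F, hF, h⟩ := mapClusterPt_iff_ultrafilter.1 h
  exact ⟨F, hF, fun f => tendsto_pi_nhds.1 h f⟩

variable [T2Space X] [LocallyCompactSpace X] [SecondCountableTopology X] [BorelSpace X]

/-- Inner regularity reduces to compact `K ⊆ O`, and a compactly supported Urysohn function between
`K` and `O` is an admissible test function. With `O = X` it also bounds the total mass, although
mass may escape to infinity. -/
theorem HomDyn.IsWeakStarLimitPoint.measure_le_of_isOpen {ρ : Measure X} [ρ.Regular]
    {μs : ℕ → Measure X} (h : IsWeakStarLimitPoint ρ μs) {O : Set X} (hO : IsOpen O) {B : ℝ≥0∞} (hB : B ≠ ∞) (hμ : ∀ k, μs k O ≤ B) : ρ O ≤ B := by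
  rw [hO.measure_eq_iSup_isCompact]
  refine iSup₂_le fun K hKO => iSup_le fun hK => ?_
  obtain ⟨f, hf1, hf0, hfc, hf01⟩ := exists_continuous_one_zero_of_isCompact hK hO.isClosed_compl
    (Set.disjoint_compl_right_iff_subset.2 hKO)
  let F : C_c(X, ℝ) := ⟨f, hfc⟩
  obtain ⟨𝓕, -, hlim⟩ := h.exists_ultrafilter
  have hle : ∀ k, ∫ x, F x ∂(μs k) ≤ B.toReal := by
    intro k
    have hOtop : μs k O ≠ ∞ := ne_top_of_le_ne_top hB (hμ k)
    have : ∀ x, F x ≤ O.indicator (fun _ => (1 : ℝ)) x := by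
      intro x
      by_cases hx : x ∈ O
      · rw [Set.indicator_of_mem hx]
        exact (hf01 x).2
      · rw [Set.indicator_of_notMem hx]
        exact (hf0 hx).le
    calc ∫ x, F x ∂(μs k) ≤ ∫ x, O.indicator (fun _ => (1 : ℝ)) x ∂(μs k) := by
          refine integral_mono_of_nonneg (Eventually.of_forall fun x => (hf01 x).1) ?_
            (Eventually.of_forall this)
          exact (integrable_indicator_iff hO.measurableSet).2 (integrableOn_const hOtop)
      _ = (μs k).real O := by simp [integral_indicator_const _ hO.measurableSet]
      _ ≤ B.toReal := ENNReal.toReal_mono hB (hμ k)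
  have hρ : ∫ x, F x ∂ρ ≤ B.toReal := le_of_tendsto' (hlim F) hle
  have hint : Integrable F ρ := F.continuous.integrable_of_hasCompactSupport F.hasCompactSupport
  have h2 : ρ.real K ≤ ∫ x, F x ∂ρ := by
    rw [← integral_indicator_one hK.measurableSet]
    refine integral_mono_of_nonneg
      (Eventually.of_forall fun x => Set.indicator_nonneg (fun _ _ => zero_le_one) x) hint
      (Eventually.of_forall fun x => ?_)
    by_cases hx : x ∈ K
    · rw [Set.indicator_of_mem hx]
      exact (hf1 hx).ge
    · rw [Set.indicator_of_notMem hx]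
      exact (hf01 x).1
  rw [← ENNReal.ofReal_toReal hK.measure_lt_top.ne, ← ENNReal.ofReal_toReal hB]
  exact ENNReal.ofReal_le_ofReal (h2.trans hρ)

theorem integral_cesaroAverage {T : X → X} (hT : Continuous T) {μ : Measure X}
    [IsProbabilityMeasure μ] (f : C_c(X, ℝ)) (k : ℕ) :
    ∫ x, f x ∂(cesaroAverage T μ k) = (k : ℝ)⁻¹ * ∑ l ∈ Finset.range k, ∫ x, f (T^[l] x) ∂μ := by
  have hprob : ∀ l, IsProbabilityMeasure (μ.map T^[l]) := fun l =>
    Measure.isProbabilityMeasure_map (hT.iterate l).measurable.aemeasurable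
  rw [cesaroAverage, integral_smul_measure, integral_finsetSum_measure]
  · simp only [ENNReal.toReal_inv, ENNReal.toReal_natCast, smul_eq_mul]
    congr 1
    refine Finset.sum_congr rfl fun l _ => ?_
    exact integral_map (hT.iterate l).measurable.aemeasurable
      f.continuous.aestronglyMeasurable
  · intro l _
    exact f.continuous.integrable_of_hasCompactSupport f.hasCompactSupport

/-- The averages of `f ∘ T` and `f` telescope to a difference of order `1/k`. That `T` is a
homeomorphism keeps `f ∘ T` compactly supported. -/
theorem HomDyn.IsWeakStarLimitPoint.map_eq {T : X ≃ₜ X} {μ ρ : Measure X} [IsProbabilityMeasure μ]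
    [ρ.Regular] (h : IsWeakStarLimitPoint ρ (cesaroAverage T μ)) : ρ.map T = ρ := by
  have hreg : (ρ.map T).Regular := Measure.Regular.map T
  refine Measure.ext_of_integral_eq_on_compactlySupported fun f => ?_
  refine (integral_map T.continuous.measurable.aemeasurable
    f.continuous.aestronglyMeasurable).trans ?_
  let g : C_c(X, ℝ) := ⟨⟨fun x => f (T x), f.continuous.comp T.continuous⟩,
    f.hasCompactSupport.comp_homeomorph T⟩
  obtain ⟨𝓕, h𝓕, hlim⟩ := h.exists_ultrafilter
  obtain ⟨B, hB⟩ : ∃ B, ∀ x, ‖f x‖ ≤ B := by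
    exact f.hasCompactSupport.exists_bound_of_continuous f.continuous
  have hbd : ∀ l, |∫ x, f (T^[l] x) ∂μ| ≤ B := by
    intro l
    have := norm_integral_le_of_norm_le_const (μ := μ) (C := B)
      (Eventually.of_forall fun x => hB (T^[l] x))
    simpa using this
  have hdiff : Tendsto (fun k : ℕ => ∫ x, g x ∂(cesaroAverage T μ k) -
      ∫ x, f x ∂(cesaroAverage T μ k)) atTop (𝓝 0) := by
    have hz : Tendsto (fun k : ℕ => (2 * B) * (k : ℝ)⁻¹) atTop (𝓝 0) := by
      simpa using (tendsto_inv_atTop_nhds_zero_nat (𝕜 := ℝ)).const_mul (2 * B)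
    refine squeeze_zero_norm (fun k => ?_) hz
    rw [integral_cesaroAverage T.continuous, integral_cesaroAverage T.continuous, ← mul_sub]
    have : ∀ l, ∫ x, g (T^[l] x) ∂μ = ∫ x, f (T^[l + 1] x) ∂μ := fun l => by
      simp only [Function.iterate_succ_apply']
      rfl
    simp_rw [this]
    rw [← Finset.sum_sub_distrib, Finset.sum_range_sub (fun l => ∫ x, f (T^[l] x) ∂μ), norm_mul,
      mul_comm]
    have hk : ‖((k : ℝ)⁻¹)‖ = (k : ℝ)⁻¹ := by
      rw [Real.norm_eq_abs, abs_of_nonneg (by positivity)]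
    rw [hk]
    refine mul_le_mul_of_nonneg_right ?_ (by positivity)
    calc _ ≤ |∫ x, f (T^[k] x) ∂μ| + |∫ x, f (T^[0] x) ∂μ| := norm_sub_le _ _
      _ ≤ 2 * B := by linarith [hbd k, hbd 0]
  have h1 := (hlim g).sub (hlim f)
  have h2 := tendsto_nhds_unique h1 (hdiff.mono_left h𝓕)
  exact sub_eq_zero.1 h2

end WeakStar

/-! ### The measure of Bowen balls under the iterates of a measure with local dimension -/

/-- A maximal set of pairwise unrelated elements, when `S` is a finite union of cliques. -/
theorem exists_maximal_pairwise_not {X ι : Type*} {S : Set X} {r : X → X → Prop}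
    (hr : ∀ x y, r x y → r y x) {t : Finset ι} {B : ι → Set X}
    (hS : ∀ x ∈ S, ∃ i ∈ t, x ∈ B i) (hB : ∀ i ∈ t, ∀ x ∈ B i, ∀ y ∈ B i, r x y) :
    ∃ P : Finset X, ↑P ⊆ S ∧ (∀ x ∈ P, ∀ y ∈ P, x ≠ y → ¬ r x y) ∧ ∀ x ∈ S, ∃ y ∈ P, r x y := by
  classical
  let N : Set ℕ := {n | ∃ P : Finset X, ↑P ⊆ S ∧ (∀ x ∈ P, ∀ y ∈ P, x ≠ y → ¬ r x y) ∧ P.card = n}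
  -- Each clique `B i` contains at most one element of `P`.
  have hbdd : BddAbove N := by
    refine ⟨t.card, ?_⟩
    rintro _ ⟨P, hPS, hP, rfl⟩
    have hS' : ∀ x : P, ∃ i ∈ t, (x : X) ∈ B i := fun x => hS x (hPS x.2)
    choose i hit hiB using hS'
    rw [← Finset.card_attach]
    refine Finset.card_le_card_of_injOn i (fun x _ => hit x) ?_
    intro x _ y _ hxy
    by_contra hne
    exact hP x x.2 y y.2 (fun h => hne (Subtype.ext h))
      (hB _ (hit x) x (hiB x) y (hxy ▸ hiB y))
  obtain ⟨P, hPS, hP, hcard⟩ := Nat.sSup_mem (s := N) ⟨0, ∅, by simp, by simp, rfl⟩ hbdd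
  refine ⟨P, hPS, hP, fun x hx => ?_⟩
  by_contra! hcon
  have hxP : x ∉ P := fun hxP => by
    obtain ⟨i, hi, hxi⟩ := hS x hx
    exact hcon x hxP (hB i hi x hxi x hxi)
  have : P.card + 1 ∈ N := by
    refine ⟨insert x P, ?_, ?_, Finset.card_insert_of_notMem hxP⟩
    · rw [Finset.coe_insert]
      exact Set.insert_subset hx hPS
    · intro y hy z hz hyz
      rcases Finset.mem_insert.1 hy with rfl | hy <;> rcases Finset.mem_insert.1 hz with rfl | hz
      · exact absurd rfl hyz
      · exact hcon z hz
      · exact fun h => hcon y ‹y ∈ P› (hr _ _ h)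
      · exact hP y hy z hz hyz
  have := le_csSup hbdd this
  omega

/-- The sum is the integral of the function counting the sets that contain a point, which is at most
`M`. -/
theorem sum_measure_le_of_card_le {X ι : Type*} [MeasurableSpace X] (μ : Measure X) (P : Finset ι)
    {A : ι → Set X} (hA : ∀ i ∈ P, MeasurableSet (A i)) {M : ℕ}
    (hM : ∀ q, ∀ I ⊆ P, (∀ i ∈ I, q ∈ A i) → I.card ≤ M) :
    ∑ i ∈ P, μ (A i) ≤ M * μ Set.univ := by
  classical
  calc ∑ i ∈ P, μ (A i) = ∑ i ∈ P, ∫⁻ x, (A i).indicator 1 x ∂μ :=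
        Finset.sum_congr rfl fun i hi => (lintegral_indicator_one (hA i hi)).symm
    _ = ∫⁻ x, ∑ i ∈ P, (A i).indicator 1 x ∂μ :=
        (lintegral_finsetSum' _ fun i hi => (measurable_one.indicator (hA i hi)).aemeasurable).symm
    _ ≤ ∫⁻ _, (M : ℝ≥0∞) ∂μ := by
        refine lintegral_mono fun x => ?_
        have : ∑ i ∈ P, (A i).indicator (1 : X → ℝ≥0∞) x = ((P.filter fun i => x ∈ A i).card : ℝ≥0∞) := by
          rw [Finset.card_filter]
          push_cast
          exact Finset.sum_congr rfl fun i _ => by simp [Set.indicator]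
        rw [this]
        exact Nat.cast_le.2 <| hM x _ (Finset.filter_subset _ _) fun i hi => (Finset.mem_filter.1 hi).2
    _ = _ := lintegral_const _

theorem exists_nhds_mul_inv_subset {G : Type*} [Group G] [TopologicalSpace G] [IsTopologicalGroup G]
    {U : Set G} (hU : U ∈ 𝓝 1) : ∃ W ∈ 𝓝 (1 : G), ∀ g ∈ W, ∀ g' ∈ W, g * g'⁻¹ ∈ U := by
  have hcont : ContinuousAt (fun p : G × G => p.1 * p.2⁻¹) (1, 1) := by fun_prop
  have := hcont (show U ∈ 𝓝 ((1 : G) * 1⁻¹) by simpa using hU)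
  rw [Filter.mem_map, nhds_prod_eq] at this
  obtain ⟨W, hW, hWP⟩ := mem_prod_self_iff.1 this
  exact ⟨W, hW, fun g hg g' hg' => hWP (show (g, g') ∈ W ×ˢ W from ⟨hg, hg'⟩)⟩

theorem exists_nhds_inv_mul_subset {G : Type*} [Group G] [TopologicalSpace G] [IsTopologicalGroup G]
    {U : Set G} (hU : U ∈ 𝓝 1) : ∃ W ∈ 𝓝 (1 : G), ∀ g ∈ W, ∀ g' ∈ W, g⁻¹ * g' ∈ U := by
  obtain ⟨W, hW, h⟩ := exists_nhds_mul_inv_subset hU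
  exact ⟨W⁻¹, inv_mem_nhds_one G hW, fun g hg g' hg' => by simpa using h _ hg _ hg'⟩

/-- Let `F s r` be neighbourhoods of `1` which behave under conjugation by `a` like boxes with side
`s` in the non-expanded directions and side `r` in the expanded ones, the expansion being by the
factor `e^τ`. If `μ` has local dimension `κ` with respect to these boxes, then the Bowen balls of
order `n` with centre in `Q` have measure `O(e^{-κτn})`, uniformly for all the images of `μ` under
the powers of `a`. -/
theorem exists_measure_bowen_le {G X : Type*} [Group G] [TopologicalSpace G]
    [IsTopologicalGroup G] [LocallyCompactSpace G] [TopologicalSpace X] [MulAction G X]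
    [MeasurableSpace X] (a : G) (hop : ∀ x : X, IsOpenMap (fun g : G => g • x)) {Q : Set X}
    (hinj : ∃ V ∈ 𝓝 (1 : G), ∀ z ∈ Q, ∀ g ∈ V, ∀ g' ∈ V, g • z = g' • z → g = g')
    (F : ℝ → ℝ → Set G) {τ κ : ℝ} (hκ : 0 < κ)
    (hF0 : ∀ s r r', r ≤ r' → F s r ⊆ F s r') (hF1 : ∀ s r, 0 < s → 0 < r → F s r ∈ 𝓝 1)
    (hF2 : ∀ V ∈ 𝓝 (1 : G), ∃ s₁ > 0, ∀ s, 0 < s → s ≤ s₁ → ∀ l : ℕ,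
      ∀ f ∈ F s (s * Real.exp (-τ * l)), a ^ l * f * (a ^ l)⁻¹ ∈ V)
    (hF3 : ∀ s > 0, ∃ c > 0, ∃ E ∈ 𝓝 (1 : G), ∃ V ∈ 𝓝 (1 : G), ∀ h ∈ E, ∀ k : ℕ,
      a ^ k * h * (a ^ k)⁻¹ ∈ V → h ∈ F s (c * Real.exp (-τ * k)))
    (hF4 : ∀ s r (x : X), MeasurableSet ((fun g : G => g • x) '' F s r))
    (hτ : 0 ≤ τ) {μ : Measure X} [IsProbabilityMeasure μ] (hsupp : IsCompact μ.support)
    (hsupp0 : μ μ.supportᶜ = 0) {lam : Measure X} [IsFiniteMeasure lam] {C₀ : ℝ≥0} {s₀ : ℝ}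
    (hs₀ : 0 < s₀)
    (hμ : ∀ (s s' δ : ℝ) (x : X), 0 < s' → s' ≤ s → s < s₀ → 0 < δ → δ < 1 → x ∈ μ.support →
      μ ((fun g : G => g • x) '' F s (δ * s')) ≤
        C₀ * ENNReal.ofReal (δ ^ κ) * lam ((fun g : G => g • x) '' F s s')) :
    ∃ V ∈ 𝓝 (1 : G), ∀ U ⊆ V, ∃ C : ℝ, 1 ≤ C ∧ ∀ n l : ℕ, ∀ z ∈ Q,
      μ {x | a ^ l • x ∈ (fun g : G => g • z) '' bowenSet a U n} ≤
        ENNReal.ofReal (C * Real.exp (-(κ * τ)) ^ n) := by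
  classical
  obtain ⟨V₀, hV₀, hinj⟩ := hinj
  obtain ⟨V₁, hV₁, hV₁₀⟩ := exists_nhds_one_split hV₀
  obtain ⟨Kc, hKc, hKc1⟩ := exists_compact_mem_nhds (1 : G)
  obtain ⟨s₁, hs₁, hF2⟩ := hF2 (V₁ ∩ Kc) (inter_mem hV₁ hKc1)
  set s := min s₁ (s₀ / 2) with hs
  have hs0 : 0 < s := lt_min hs₁ (by linarith)
  have hss₀ : s < s₀ := (min_le_right _ _).trans_lt (by linarith)
  have hF2 := hF2 s hs0 (min_le_left _ _)
  obtain ⟨c, hc, E, hE, V₃, hV₃, hF3⟩ := hF3 s hs0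
  obtain ⟨V₂, hV₂, hV₂₃⟩ := exists_nhds_mul_inv_subset hV₃
  obtain ⟨W, hW, hWE⟩ := exists_nhds_inv_mul_subset hE
  -- Cells for a later pigeonhole argument: two elements of `Kc` in the same cell have quotient in
  -- `E`. Their number, the overlap bound, is fixed before `U`, `n` and `l`.
  obtain ⟨t, -, ht⟩ := hKc.elim_nhds_subcover (fun g => (fun w => g⁻¹ * w) ⁻¹' W) fun g _ =>
    (continuous_const_mul g⁻¹).continuousAt.preimage_mem_nhds (by simpa using hW)
  refine ⟨V₁ ∩ V₂, inter_mem hV₁ hV₂, fun U hU => ?_⟩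
  set M := t.card
  set C : ℝ := max 1 ((c / s) ^ κ * max 1 (C₀ * (M * lam.real Set.univ))) with hC
  refine ⟨C, le_max_left _ _, fun n l z hz => ?_⟩
  set δ := c / s * Real.exp (-τ * n) with hδ
  have hδ0 : 0 < δ := by positivity
  have hδκ : δ ^ κ = (c / s) ^ κ * Real.exp (-(κ * τ)) ^ n := by
    rw [hδ, Real.mul_rpow (by positivity) (by positivity), ← Real.exp_mul, ← Real.exp_nat_mul]
    congr 2
    ring
  have hCδ : δ ^ κ * max 1 (C₀ * (M * lam.real Set.univ)) ≤ C * Real.exp (-(κ * τ)) ^ n := by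
    rw [hδκ]
    calc _ = ((c / s) ^ κ * max 1 (C₀ * (M * lam.real Set.univ))) * Real.exp (-(κ * τ)) ^ n := by ring
      _ ≤ _ := by gcongr; exact le_max_right _ _
  -- The local dimension needs `δ < 1`. Otherwise the claimed bound exceeds `1`, because of the
  -- inner `max 1` in `C`.
  rcases le_or_gt 1 δ with h1 | h1
  · refine prob_le_one.trans ?_
    rw [← ENNReal.ofReal_one]
    refine ENNReal.ofReal_le_ofReal (le_trans ?_ hCδ)
    have := Real.one_le_rpow h1 hκ.le
    nlinarith [le_max_left 1 (C₀ * (M * lam.real Set.univ))]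
  -- The wide tubes have the unstable width that `a^l` expands to `s`; the thin width `δ * s'` is `c
  -- e^{-τ(l+n)}`, the scale at which order `l + n` is resolved.
  set s' := s * Real.exp (-τ * l) with hs'
  have hs'0 : 0 < s' := by positivity
  have hs's : s' ≤ s := by
    refine mul_le_of_le_one_right hs0.le (Real.exp_le_one_iff.2 ?_)
    have : (0 : ℝ) ≤ l := by positivity
    nlinarith
  have hρ : δ * s' = c * Real.exp (-τ * (l + n : ℕ)) := by
    rw [hδ, hs']
    have : Real.exp (-τ * (l + n : ℕ)) = Real.exp (-τ * n) * Real.exp (-τ * l) := by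
      rw [← Real.exp_add]
      congr 1
      push_cast
      ring
    rw [this]
    field_simp
  set Fρ := F s (δ * s') with hFρ
  have hFρ1 : Fρ ∈ 𝓝 1 := hF1 _ _ hs0 (by positivity)
  obtain ⟨B, hB, hBF⟩ := exists_nhds_mul_inv_subset hFρ1
  obtain ⟨B', hB'B, hB'o, hB'1⟩ := mem_nhds_iff.1 hB
  set S : Set X := {x | x ∈ μ.support ∧ a ^ l • x ∈ (fun g : G => g • z) '' bowenSet a U n}
  let r : X → X → Prop := fun x y =>
    x ∈ (fun g : G => g • y) '' Fρ ∧ y ∈ (fun g : G => g • x) '' Fρ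
  obtain ⟨tX, -, htX⟩ := hsupp.elim_nhds_subcover (fun x => (fun g : G => g • x) '' B')
    fun x _ => (hop x _ hB'o).mem_nhds ⟨1, hB'1, one_smul _ _⟩
  obtain ⟨P, hPS, hPsep, hPmax⟩ := exists_maximal_pairwise_not (S := S) (r := r) (t := tX)
    (B := fun x => (fun g : G => g • x) '' B') (fun x y h => ⟨h.2, h.1⟩)
    (fun x hx => by simpa using htX hx.1) (by
      rintro q - _ ⟨g, hg, rfl⟩ _ ⟨g', hg', rfl⟩
      exact ⟨⟨g * g'⁻¹, hBF _ (hB'B hg) _ (hB'B hg'), by simp [mul_smul]⟩,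
        ⟨g' * g⁻¹, hBF _ (hB'B hg') _ (hB'B hg), by simp [mul_smul]⟩⟩)
  have hmult : ∀ q, ∀ I ⊆ P, (∀ x ∈ I, q ∈ (fun g : G => g • x) '' F s s') → I.card ≤ M := by
    intro q I hIP hI
    choose! f hf hfq using hI
    have hlab : ∀ x ∈ I, ∃ g ∈ t, g⁻¹ * f x ∈ W := by
      intro x hx
      have hfx : f x ∈ F s s' := hf x hx
      have : f x ∈ Kc := by
        have h0 : f x ∈ F s (s * Real.exp (-τ * (0 : ℕ))) := by simpa using hF0 s _ _ hs's hfx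
        simpa using (hF2 0 _ h0).2
      simpa using ht this
    choose! γ hγt hγW using hlab
    refine Finset.card_le_card_of_injOn γ hγt ?_
    intro x hx y hy hxy
    by_contra hne
    have key : ∀ x ∈ I, ∀ y ∈ I, γ x = γ y → x ∈ (fun g : G => g • y) '' Fρ := by
      intro x hx y hy hxy
      obtain ⟨-, d, hd, hdx⟩ := hPS (hIP hx)
      obtain ⟨-, d', hd', hdy⟩ := hPS (hIP hy)
      have hE' : (f x)⁻¹ * f y ∈ E := by
        have := hWE _ (hγW x hx) _ (hxy ▸ hγW y hy)
        simpa [mul_assoc] using this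
      have hU1 : ∀ d ∈ bowenSet a U n, d ∈ V₁ := fun d hd => by
        simpa using (hU (hd 0 (Nat.zero_le _))).1
      -- Both sides send `z` to `a^l • q` and are small, so injectivity at `z` lifts the coincidence
      -- in `X` to an identity in `G`.
      have heq : (a ^ l * f x * (a ^ l)⁻¹) * d = (a ^ l * f y * (a ^ l)⁻¹) * d' := by
        refine hinj z hz _ (hV₁₀ _ (hF2 l _ (hf x hx)).1 _ (hU1 d hd)) _
          (hV₁₀ _ (hF2 l _ (hf y hy)).1 _ (hU1 d' hd')) ?_
        have h1 : (a ^ l * f x * (a ^ l)⁻¹ * d) • z = a ^ l • q := by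
          rw [mul_smul, show d • z = a ^ l • x from hdx, ← hfq x hx]
          simp [mul_smul]
        have h2 : (a ^ l * f y * (a ^ l)⁻¹ * d') • z = a ^ l • q := by
          rw [mul_smul, show d' • z = a ^ l • y from hdy, ← hfq y hy]
          simp [mul_smul]
        rw [h1, h2]
      -- Hence `(f x)⁻¹ * f y` stays controlled up to time `l + n`, which forces it into the thin
      -- tube and contradicts separation.
      have hconj : a ^ (l + n) * ((f x)⁻¹ * f y) * (a ^ (l + n))⁻¹ =
          (a ^ n * d * (a ^ n)⁻¹) * (a ^ n * d' * (a ^ n)⁻¹)⁻¹ := by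
        have : a ^ l * ((f x)⁻¹ * f y) * (a ^ l)⁻¹ = d * d'⁻¹ := by
          have h3 : a ^ l * f y * (a ^ l)⁻¹ = (a ^ l * f x * (a ^ l)⁻¹) * d * d'⁻¹ := by
            rw [heq]; simp
          calc a ^ l * ((f x)⁻¹ * f y) * (a ^ l)⁻¹
              = (a ^ l * f x * (a ^ l)⁻¹)⁻¹ * (a ^ l * f y * (a ^ l)⁻¹) := by group
            _ = d * d'⁻¹ := by rw [h3]; group
        calc a ^ (l + n) * ((f x)⁻¹ * f y) * (a ^ (l + n))⁻¹
            = a ^ n * (a ^ l * ((f x)⁻¹ * f y) * (a ^ l)⁻¹) * (a ^ n)⁻¹ := by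
              rw [add_comm, pow_add]; group
          _ = _ := by rw [this]; group
      have hmem : (f x)⁻¹ * f y ∈ Fρ := by
        rw [hFρ, hρ]
        refine hF3 _ hE' _ ?_
        rw [hconj]
        exact hV₂₃ _ (hU (hd n le_rfl)).2 _ (hU (hd' n le_rfl)).2
      refine ⟨_, hmem, ?_⟩
      simp only [mul_smul]
      rw [show f y • y = q from hfq y hy, ← hfq x hx]
      simp
    exact hPsep x (hIP hx) y (hIP hy) hne ⟨key x hx y hy hxy, key y hy x hx hxy.symm⟩
  calc μ {x | a ^ l • x ∈ (fun g : G => g • z) '' bowenSet a U n}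
      ≤ μ (S ∪ μ.supportᶜ) := measure_mono fun x hx => by
        by_cases hxs : x ∈ μ.support
        · exact Or.inl ⟨hxs, hx⟩
        · exact Or.inr hxs
    _ ≤ μ S := by simpa [hsupp0] using measure_union_le (μ := μ) S μ.supportᶜ
    _ ≤ μ (⋃ x ∈ P, (fun g : G => g • x) '' Fρ) := measure_mono fun x hx => by
        obtain ⟨y, hy, hxy⟩ := hPmax x hx
        exact Set.mem_iUnion₂.2 ⟨y, hy, hxy.1⟩
    _ ≤ ∑ x ∈ P, μ ((fun g : G => g • x) '' Fρ) := measure_biUnion_finset_le _ _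
    _ ≤ ∑ x ∈ P, C₀ * ENNReal.ofReal (δ ^ κ) * lam ((fun g : G => g • x) '' F s s') :=
        Finset.sum_le_sum fun x hx => hμ s s' δ x hs'0 hs's hss₀ hδ0 h1 (hPS hx).1
    _ ≤ C₀ * ENNReal.ofReal (δ ^ κ) * (M * lam Set.univ) := by
        rw [← Finset.mul_sum]
        gcongr
        exact sum_measure_le_of_card_le lam P (fun x _ => hF4 _ _ x) hmult
    _ = ENNReal.ofReal (δ ^ κ * (C₀ * (M * lam.real Set.univ))) := by
        rw [ENNReal.ofReal_mul (by positivity), ENNReal.ofReal_mul (by positivity),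
          ENNReal.ofReal_mul (by positivity), Measure.real, ENNReal.ofReal_toReal (by finiteness)]
        simp
        ring
    _ ≤ _ := by
        refine ENNReal.ofReal_le_ofReal (le_trans ?_ hCδ)
        gcongr
        exact le_max_right _ _

/-! ### Small balls of a linear group -/

/-- Near `1` the group is approximately linear, so the covering problem is invariant under scaling.
One cover of the ball of radius `c` by balls of radius `η`, rescaled by `r`, serves all small `r`;
hence `K` precedes `V`. -/
theorem exists_cover_conj_ball {A G : Type*} [NormedRing A] [NormedAlgebra ℝ A] [ProperSpace A]
    [Group G] [TopologicalSpace G] (f : G →* A) (hf : IsInducing f) (a : G) :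
    ∃ K : ℕ, ∀ V ∈ 𝓝 (1 : G), ∃ U : Set G, IsOpen U ∧ (1 : G) ∈ U ∧ U ⊆ V ∧
      ∃ D : Fin K → Set G, (∀ g ∈ U, ∃ j, a * g * a⁻¹ ∈ D j) ∧
        ∀ j, ∀ g ∈ D j, ∀ g' ∈ D j, g' * g⁻¹ ∈ U := by
  set c := ‖f a‖ * ‖f a⁻¹‖
  set e := ‖(1 : A)‖
  set η := 1 / (8 * (e + 1))
  have he : 0 ≤ e := norm_nonneg _
  have hη : 0 < η := by positivity
  obtain ⟨t, -, ht⟩ := (isCompact_closedBall (0 : A) c).elim_nhds_subcover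
    (fun m => Metric.ball m η) fun m _ => Metric.ball_mem_nhds m hη
  refine ⟨t.card, fun V hV => ?_⟩
  rw [hf.nhds_eq_comap, map_one] at hV
  obtain ⟨O, hO, hOV⟩ := hV
  obtain ⟨r₀, hr₀, hr₀O⟩ := Metric.mem_nhds_iff.1 hO
  have hc : 0 ≤ c := by positivity
  set r := min r₀ (1 / (2 * (c + 1))) with hr
  have hr0 : 0 < r := lt_min hr₀ (by positivity)
  -- This gives `‖f g⁻¹‖ ≤ 2e` on the pieces. The value of `η` then makes `2rη · 2e` less than `r`.
  have hcr : c * r ≤ 1 / 2 := by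
    calc c * r ≤ c * (1 / (2 * (c + 1))) := by gcongr; exact min_le_right _ _
      _ ≤ 1 / 2 := by
        rw [mul_one_div, div_le_div_iff₀ (by positivity) (by positivity)]
        linarith
  refine ⟨f ⁻¹' Metric.ball 1 r, Metric.isOpen_ball.preimage hf.continuous, ?_, ?_, ?_⟩
  · simpa using hr0
  · exact (Set.preimage_mono ((Metric.ball_subset_ball (min_le_left _ _)).trans hr₀O)).trans hOV
  refine ⟨fun j => {g | ‖f g - 1‖ ≤ c * r ∧ ‖f g - 1 - r • (t.equivFin.symm j : A)‖ < r * η}, ?_, ?_⟩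
  · intro g hg
    have hg' : ‖f g - 1‖ < r := by simpa [dist_eq_norm] using hg
    have h1 : f (a * g * a⁻¹) - 1 = f a * (f g - 1) * f a⁻¹ := by
      rw [mul_sub, sub_mul, mul_one, ← map_mul, ← map_mul, ← map_mul, mul_inv_cancel, map_one]
    have h2 : ‖f (a * g * a⁻¹) - 1‖ ≤ c * r := by
      rw [h1]
      calc _ ≤ ‖f a‖ * ‖f g - 1‖ * ‖f a⁻¹‖ :=
            (norm_mul_le _ _).trans (by gcongr; exact norm_mul_le _ _)
        _ ≤ ‖f a‖ * r * ‖f a⁻¹‖ := by gcongr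
        _ = c * r := by ring
    have h3 : r⁻¹ • (f (a * g * a⁻¹) - 1) ∈ Metric.closedBall (0 : A) c := by
      rw [mem_closedBall_zero_iff, norm_smul, norm_inv, Real.norm_of_nonneg hr0.le,
        inv_mul_le_iff₀ hr0]
      linarith
    obtain ⟨m, hm, hgm⟩ := Set.mem_iUnion₂.1 (ht h3)
    refine ⟨t.equivFin ⟨m, hm⟩, h2, ?_⟩
    rw [Equiv.symm_apply_apply]
    have : f (a * g * a⁻¹) - 1 - r • m = r • (r⁻¹ • (f (a * g * a⁻¹) - 1) - m) := by
      rw [smul_sub, smul_inv_smul₀ hr0.ne']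
    rw [this, norm_smul, Real.norm_of_nonneg hr0.le]
    have := dist_eq_norm (r⁻¹ • (f (a * g * a⁻¹) - 1)) m ▸ (Metric.mem_ball.1 hgm)
    gcongr
  · intro j g hg g' hg'
    set m := (t.equivFin.symm j : A)
    have h1 : ‖f g' - f g‖ ≤ 2 * (r * η) := by
      calc ‖f g' - f g‖ = ‖(f g' - 1 - r • m) - (f g - 1 - r • m)‖ := by congr 1; abel
        _ ≤ ‖f g' - 1 - r • m‖ + ‖f g - 1 - r • m‖ := norm_sub_le _ _
        _ ≤ _ := by linarith [hg.2, hg'.2]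
    have h2 : ‖f g⁻¹‖ ≤ 2 * e := by
      have : f g⁻¹ = 1 - (f g - 1) * f g⁻¹ := by
        rw [sub_mul, ← map_mul, mul_inv_cancel, map_one, one_mul]; abel
      have h3 : ‖f g⁻¹‖ ≤ e + 1 / 2 * ‖f g⁻¹‖ := by
        calc ‖f g⁻¹‖ = ‖1 - (f g - 1) * f g⁻¹‖ := by rw [← this]
          _ ≤ e + ‖f g - 1‖ * ‖f g⁻¹‖ := (norm_sub_le _ _).trans (by gcongr; exact norm_mul_le _ _)
          _ ≤ _ := by gcongr; exact hg.1.trans hcr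
      linarith
    have h4 : f (g' * g⁻¹) - 1 = (f g' - f g) * f g⁻¹ := by
      rw [sub_mul, ← map_mul, ← map_mul, mul_inv_cancel, map_one]
    simp only [Set.mem_preimage, Metric.mem_ball, dist_eq_norm]
    rw [h4]
    calc _ ≤ 2 * (r * η) * (2 * e) := (norm_mul_le _ _).trans (by gcongr)
      _ = r * (e / (2 * (e + 1))) := by simp only [η]; field_simp; ring
      _ < r := by
        refine mul_lt_of_lt_one_right hr0 ?_
        rw [div_lt_one (by positivity)]
        linarith

/-! ### The closed subgroup theorem -/

theorem hasStrictFDerivAt_exp_mul_exp {A E : Type*} [NormedRing A] [NormedAlgebra ℝ A]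
    [CompleteSpace A] [NormedAddCommGroup E] [NormedSpace ℝ E] (P₁ P₂ P₃ P₄ : E →L[ℝ] A) :
    HasStrictFDerivAt (fun x => NormedSpace.exp (P₁ x) * NormedSpace.exp (P₂ x) *
      NormedSpace.exp (P₃ x) * NormedSpace.exp (P₄ x)) (P₁ + P₂ + P₃ + P₄) 0 := by
  have hexp : ∀ P : E →L[ℝ] A, HasStrictFDerivAt (fun x => NormedSpace.exp (P x)) P 0 := by
    intro P
    have h0 : HasStrictFDerivAt (NormedSpace.exp : A → A) (1 : A →L[ℝ] A) (P 0) := by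
      rw [map_zero]
      exact hasStrictFDerivAt_exp_zero (𝕂 := ℝ)
    exact h0.comp (0 : E) P.hasStrictFDerivAt
  refine ((((hexp P₁).mul' (hexp P₂)).mul' (hexp P₃)).mul' (hexp P₄)).congr_fderiv ?_
  refine ContinuousLinearMap.ext fun x => ?_
  simp
  abel

section ClosedSubgroup

variable {N : ℕ} {G : Subgroup (Matrix.SpecialLinearGroup (Fin N) ℝ)}

/-- The inclusion of a linear group in the ring of matrices. -/
def toMatrixHom (G : Subgroup (Matrix.SpecialLinearGroup (Fin N) ℝ)) :
    G →* Matrix (Fin N) (Fin N) ℝ where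
  toFun g := ((g : Matrix.SpecialLinearGroup (Fin N) ℝ) : Matrix (Fin N) (Fin N) ℝ)
  map_one' := by simp
  map_mul' := by simp

theorem isClosedEmbedding_toMatrixHom
    (hG : IsClosed (G : Set (Matrix.SpecialLinearGroup (Fin N) ℝ))) :
    IsClosedEmbedding (toMatrixHom G) :=
  Matrix.SpecialLinearGroup.isClosedEmbedding_val.comp hG.isClosedEmbedding_subtypeVal

variable (hG : IsClosed (G : Set (Matrix.SpecialLinearGroup (Fin N) ℝ)))

theorem mem_lieAlg_iff {X : Matrix (Fin N) (Fin N) ℝ} :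
    X ∈ lieAlg hG ↔ ∀ s : ℝ, NormedSpace.exp (s • X) ∈ Set.range (toMatrixHom G) := by
  refine forall_congr' fun s => ⟨?_, ?_⟩
  · rintro ⟨g, hg, h⟩
    exact ⟨⟨g, hg⟩, h⟩
  · rintro ⟨g, h⟩
    exact ⟨g, g.2, h⟩

attribute [local instance] Matrix.linftyOpNormedRing Matrix.linftyOpNormedAlgebra

/-- Otherwise nonzero `u_n → 0` in `𝔪` have exponentials in `G`. A limit `Y` of their directions
lies in the Lie algebra, because `exp(sY)` is a limit of integer powers of `exp(u_n)` and `G` is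
closed. But `Y` is a unit vector of `𝔪`. -/
theorem eventually_exp_mem_range {𝔪 : Submodule ℝ (Matrix (Fin N) (Fin N) ℝ)}
    (h𝔪 : Disjoint (lieAlg hG) 𝔪) :
    ∀ᶠ m : 𝔪 in 𝓝 (0 : 𝔪), NormedSpace.exp (m : Matrix (Fin N) (Fin N) ℝ) ∈
      Set.range (toMatrixHom G) → m = 0 := by
  by_contra hcon
  have hfr : ∃ᶠ m : 𝔪 in 𝓝 (0 : 𝔪), NormedSpace.exp (m : Matrix (Fin N) (Fin N) ℝ) ∈
      Set.range (toMatrixHom G) ∧ m ≠ 0 := by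
    rw [Filter.not_eventually] at hcon
    exact hcon.mono fun m hm => Classical.not_imp.1 hm
  have hfc : FirstCountableTopology (Matrix (Fin N) (Fin N) ℝ) :=
    inferInstanceAs (FirstCountableTopology (Fin N → Fin N → ℝ))
  have hgen : (𝓝 (0 : 𝔪)).IsCountablyGenerated :=
    Topology.IsInducing.subtypeVal.nhds_eq_comap (0 : 𝔪) ▸ Filter.comap.isCountablyGenerated _ _
  obtain ⟨u, hu, hum⟩ := exists_seq_forall_of_frequently hfr
  have hpos : ∀ n, 0 < ‖u n‖ := fun n => norm_pos_iff.2 (hum n).2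
  have hsph : ∀ n, (‖u n‖⁻¹ • u n) ∈ Metric.sphere (0 : 𝔪) 1 := fun n => by
    rw [mem_sphere_zero_iff_norm, norm_smul, norm_inv, norm_norm, inv_mul_cancel₀ (hpos n).ne']
  obtain ⟨Y, hY, φ, hφ, hlim⟩ := (isCompact_sphere (0 : 𝔪) 1).tendsto_subseq hsph
  have hu0 : Tendsto (fun n => ‖u (φ n)‖) atTop (𝓝 0) := by
    simpa using (hu.comp hφ.tendsto_atTop).norm
  have hcl := (isClosedEmbedding_toMatrixHom hG).isClosed_range
  have hnonneg : ∀ s : ℝ, 0 ≤ s →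
      NormedSpace.exp (s • (Y : Matrix (Fin N) (Fin N) ℝ)) ∈ Set.range (toMatrixHom G) := by
    intro s hs
    have hk : Tendsto (fun n => (⌊s / ‖u (φ n)‖⌋₊ : ℝ) * ‖u (φ n)‖) atTop (𝓝 s) := by
      refine tendsto_of_tendsto_of_tendsto_of_le_of_le (g := fun n => s - ‖u (φ n)‖)
        (h := fun _ => s) (by simpa using tendsto_const_nhds.sub hu0) tendsto_const_nhds ?_ ?_
      · intro n
        have := (Nat.lt_floor_add_one (s / ‖u (φ n)‖)).le
        rw [div_le_iff₀ (hpos _)] at this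
        show s - ‖u (φ n)‖ ≤ _
        linarith
      · intro n
        have := Nat.floor_le (div_nonneg hs (hpos (φ n)).le)
        rwa [le_div_iff₀ (hpos _)] at this
    have h1 : Tendsto (fun n => ((⌊s / ‖u (φ n)‖⌋₊ : ℝ) * ‖u (φ n)‖) • (‖u (φ n)‖⁻¹ • u (φ n)))
        atTop (𝓝 (s • Y)) := hk.smul hlim
    have h2 : Tendsto (fun n => NormedSpace.exp
        (⌊s / ‖u (φ n)‖⌋₊ • (u (φ n) : Matrix (Fin N) (Fin N) ℝ))) atTop
        (𝓝 (NormedSpace.exp (s • (Y : Matrix (Fin N) (Fin N) ℝ)))) := by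
      let _ : NormedAlgebra ℚ (Matrix (Fin N) (Fin N) ℝ) := NormedAlgebra.restrictScalars ℚ ℝ _
      refine (NormedSpace.exp_continuous.tendsto _).comp ?_
      refine ((continuous_subtype_val.tendsto _).comp h1).congr fun n => ?_
      simp only [Function.comp, Submodule.coe_smul, smul_smul]
      rw [mul_assoc, mul_inv_cancel₀ (hpos _).ne', mul_one, Nat.cast_smul_eq_nsmul]
    refine hcl.mem_of_tendsto h2 (Eventually.of_forall fun n => ?_)
    obtain ⟨g, hg⟩ := (hum (φ n)).1
    exact ⟨g ^ ⌊s / ‖u (φ n)‖⌋₊, by rw [map_pow, hg, Matrix.exp_nsmul]⟩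
  have hYg : (Y : Matrix (Fin N) (Fin N) ℝ) ∈ lieAlg hG := by
    rw [mem_lieAlg_iff]
    intro s
    rcases le_total 0 s with hs | hs
    · exact hnonneg s hs
    · obtain ⟨g, hg⟩ := hnonneg (-s) (by linarith)
      refine ⟨g⁻¹, ?_⟩
      have : NormedSpace.exp (s • (Y : Matrix (Fin N) (Fin N) ℝ)) =
          (NormedSpace.exp ((-s) • (Y : Matrix (Fin N) (Fin N) ℝ)))⁻¹ := by
        rw [← Matrix.exp_neg]; simp
      rw [this, ← hg]
      refine (Matrix.inv_eq_right_inv ?_).symm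
      rw [← map_mul, mul_inv_cancel, map_one]
  have h0 := Submodule.disjoint_def.1 h𝔪 _ hYg Y.2
  have : Y = 0 := Subtype.ext h0
  rw [this] at hY
  simp at hY

/-- Canonical coordinates of the second kind: the product of the exponentials of linear maps into
the Lie algebra with jointly spanning images covers neighbourhoods of the identity. -/
theorem exp_mul_exp_mul_exp_mem_nhds {E₁ E₂ E₃ : Type*}
    [NormedAddCommGroup E₁] [NormedSpace ℝ E₁] [FiniteDimensional ℝ E₁]
    [NormedAddCommGroup E₂] [NormedSpace ℝ E₂] [FiniteDimensional ℝ E₂]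
    [NormedAddCommGroup E₃] [NormedSpace ℝ E₃] [FiniteDimensional ℝ E₃]
    (f₁ : E₁ →ₗ[ℝ] lieAlg hG) (f₂ : E₂ →ₗ[ℝ] lieAlg hG) (f₃ : E₃ →ₗ[ℝ] lieAlg hG)
    (hf : LinearMap.range f₁ ⊔ LinearMap.range f₂ ⊔ LinearMap.range f₃ = ⊤)
    {B : Set (E₁ × E₂ × E₃)} (hB : B ∈ 𝓝 0) :
    (fun p : E₁ × E₂ × E₃ => expG hG (f₁ p.1) * expG hG (f₂ p.2.1) * expG hG (f₃ p.2.2)) '' B ∈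
      𝓝 (1 : G) := by
  obtain ⟨𝔪, h𝔪⟩ := Submodule.exists_isCompl (lieAlg hG)
  let _ : NormedAlgebra ℚ (Matrix (Fin N) (Fin N) ℝ) := NormedAlgebra.restrictScalars ℚ ℝ _
  have hcomplete : CompleteSpace (Matrix (Fin N) (Fin N) ℝ) := FiniteDimensional.complete ℝ (Matrix (Fin N) (Fin N) ℝ)
  let L₁ : E₁ →L[ℝ] Matrix (Fin N) (Fin N) ℝ := LinearMap.toContinuousLinearMap ((lieAlg hG).subtype ∘ₗ f₁)
  let L₂ : E₂ →L[ℝ] Matrix (Fin N) (Fin N) ℝ := LinearMap.toContinuousLinearMap ((lieAlg hG).subtype ∘ₗ f₂)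
  let L₃ : E₃ →L[ℝ] Matrix (Fin N) (Fin N) ℝ := LinearMap.toContinuousLinearMap ((lieAlg hG).subtype ∘ₗ f₃)
  let L₄ : 𝔪 →L[ℝ] Matrix (Fin N) (Fin N) ℝ := 𝔪.subtypeL
  let E := (E₁ × E₂ × E₃) × 𝔪
  let P₁ : E →L[ℝ] Matrix (Fin N) (Fin N) ℝ := L₁ ∘L ContinuousLinearMap.fst ℝ _ _ ∘L ContinuousLinearMap.fst ℝ _ _
  let P₂ : E →L[ℝ] Matrix (Fin N) (Fin N) ℝ := L₂ ∘L ContinuousLinearMap.fst ℝ _ _ ∘L ContinuousLinearMap.snd ℝ _ _ ∘L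
    ContinuousLinearMap.fst ℝ _ _
  let P₃ : E →L[ℝ] Matrix (Fin N) (Fin N) ℝ := L₃ ∘L ContinuousLinearMap.snd ℝ _ _ ∘L ContinuousLinearMap.snd ℝ _ _ ∘L
    ContinuousLinearMap.fst ℝ _ _
  let P₄ : E →L[ℝ] Matrix (Fin N) (Fin N) ℝ := L₄ ∘L ContinuousLinearMap.snd ℝ _ _
  let Φ : E → Matrix (Fin N) (Fin N) ℝ := fun x => NormedSpace.exp (P₁ x) * NormedSpace.exp (P₂ x) *
    NormedSpace.exp (P₃ x) * NormedSpace.exp (P₄ x)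
  have hΦ : HasStrictFDerivAt Φ (P₁ + P₂ + P₃ + P₄) 0 :=
    hasStrictFDerivAt_exp_mul_exp P₁ P₂ P₃ P₄
  have hsurj : LinearMap.range ((P₁ + P₂ + P₃ + P₄ : E →L[ℝ] Matrix (Fin N) (Fin N) ℝ) : E →ₗ[ℝ] Matrix (Fin N) (Fin N) ℝ) = ⊤ := by
    rw [LinearMap.range_eq_top]
    intro Z
    obtain ⟨X, m, hXm⟩ := Submodule.mem_sup'.1 (h𝔪.sup_eq_top ▸ Submodule.mem_top : Z ∈ lieAlg hG ⊔ 𝔪)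
    obtain ⟨w, hw, _, ⟨x₃, rfl⟩, hX⟩ := Submodule.mem_sup.1 (hf ▸ Submodule.mem_top : X ∈ _)
    obtain ⟨_, ⟨x₁, rfl⟩, _, ⟨x₂, rfl⟩, rfl⟩ := Submodule.mem_sup.1 hw
    refine ⟨((x₁, x₂, x₃), m), ?_⟩
    rw [← hXm, ← hX]
    rfl
  -- Adding the complement `𝔪` makes the derivative onto the full matrix space, so the open mapping
  -- property applies. For a value in `G` the `𝔪`-component then vanishes.
  have hmap := hΦ.map_nhds_eq_of_surj hsurj
  have hΦ0 : Φ 0 = 1 := by simp [Φ]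
  rw [hΦ0] at hmap
  have hnhds : B ×ˢ {m : 𝔪 | NormedSpace.exp (m : Matrix (Fin N) (Fin N) ℝ) ∈ Set.range (toMatrixHom G) → m = 0} ∈
      𝓝 (0 : E) := prod_mem_nhds hB (eventually_exp_mem_range hG h𝔪.disjoint)
  have him : Φ '' (B ×ˢ {m : 𝔪 | NormedSpace.exp (m : Matrix (Fin N) (Fin N) ℝ) ∈ Set.range (toMatrixHom G) → m = 0}) ∈
      𝓝 (1 : Matrix (Fin N) (Fin N) ℝ) := hmap ▸ image_mem_map hnhds
  have hpre := (isClosedEmbedding_toMatrixHom hG).continuous.continuousAt.preimage_mem_nhds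
    (show _ ∈ 𝓝 (toMatrixHom G 1) by rw [map_one]; exact him)
  filter_upwards [hpre] with g hg
  obtain ⟨⟨p, m⟩, ⟨hp, hm⟩, hpm⟩ := hg
  set q : G := expG hG (f₁ p.1) * expG hG (f₂ p.2.1) * expG hG (f₃ p.2.2) with hq
  have hqm : toMatrixHom G q * NormedSpace.exp (m : Matrix (Fin N) (Fin N) ℝ) = toMatrixHom G g := by
    rw [← hpm, hq, map_mul, map_mul]
    rfl
  have hmr : NormedSpace.exp (m : Matrix (Fin N) (Fin N) ℝ) = toMatrixHom G (q⁻¹ * g) := by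
    rw [map_mul, ← hqm, ← mul_assoc, ← map_mul, inv_mul_cancel, map_one, one_mul]
  have hm0 : m = 0 := hm ⟨_, hmr.symm⟩
  rw [hm0] at hqm
  refine ⟨p, hp, (isClosedEmbedding_toMatrixHom hG).injective ?_⟩
  rw [← hqm]
  simp [hq]

end ClosedSubgroup

/-! ### The adjoint action of a diagonalisable element -/

section Adjoint

variable {N : ℕ} {G : Subgroup (Matrix.SpecialLinearGroup (Fin N) ℝ)}

/-- Conjugation by `a` on the space of all matrices. -/
def conjEnd (a : G) : Module.End ℝ (Matrix (Fin N) (Fin N) ℝ) :=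
  LinearMap.mulLeft ℝ (toMatrixHom G a) ∘ₗ LinearMap.mulRight ℝ (toMatrixHom G a⁻¹)

theorem conjEnd_apply (a : G) (X : Matrix (Fin N) (Fin N) ℝ) :
    conjEnd a X = toMatrixHom G a * X * toMatrixHom G a⁻¹ := by
  simp [conjEnd, mul_assoc]

theorem conjEnd_eq_smul_iff (a : G) (X : Matrix (Fin N) (Fin N) ℝ) (c : ℝ) :
    conjEnd a X = c • X ↔ toMatrixHom G a * X = c • (X * toMatrixHom G a) := by
  have h1 : toMatrixHom G a * toMatrixHom G a⁻¹ = 1 := by rw [← map_mul, mul_inv_cancel, map_one]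
  have h2 : toMatrixHom G a⁻¹ * toMatrixHom G a = 1 := by rw [← map_mul, inv_mul_cancel, map_one]
  rw [conjEnd_apply]
  constructor
  · intro h
    calc toMatrixHom G a * X = toMatrixHom G a * X * toMatrixHom G a⁻¹ * toMatrixHom G a := by
          rw [mul_assoc _ (toMatrixHom G a⁻¹), h2, mul_one]
      _ = _ := by rw [h, smul_mul_assoc]
  · intro h
    rw [h, smul_mul_assoc, mul_assoc, h1, mul_one]

variable {a : G} {p : Matrix.SpecialLinearGroup (Fin N) ℝ} {d : Fin N → ℝ}

theorem conj_diagonal_facts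
    (h : ((p * a * p⁻¹ : Matrix.SpecialLinearGroup (Fin N) ℝ) : Matrix (Fin N) (Fin N) ℝ) =
      Matrix.diagonal d) :
    ∃ P P' : Matrix (Fin N) (Fin N) ℝ, P * P' = 1 ∧ P' * P = 1 ∧
      P * toMatrixHom G a = Matrix.diagonal d * P ∧
      toMatrixHom G a * P' = P' * Matrix.diagonal d ∧ ∀ i, d i ≠ 0 := by
  have h1 : (p : Matrix (Fin N) (Fin N) ℝ) * ((p⁻¹ : Matrix.SpecialLinearGroup (Fin N) ℝ) :
      Matrix (Fin N) (Fin N) ℝ) = 1 := by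
    rw [← Matrix.SpecialLinearGroup.coe_mul, mul_inv_cancel, Matrix.SpecialLinearGroup.coe_one]
  have h2 : ((p⁻¹ : Matrix.SpecialLinearGroup (Fin N) ℝ) : Matrix (Fin N) (Fin N) ℝ) *
      (p : Matrix (Fin N) (Fin N) ℝ) = 1 := by
    rw [← Matrix.SpecialLinearGroup.coe_mul, inv_mul_cancel, Matrix.SpecialLinearGroup.coe_one]
  rw [Matrix.SpecialLinearGroup.coe_mul, Matrix.SpecialLinearGroup.coe_mul] at h
  refine ⟨p, (p⁻¹ : Matrix.SpecialLinearGroup (Fin N) ℝ), h1, h2, ?_, ?_, ?_⟩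
  · rw [← h, mul_assoc _ _ (p : Matrix (Fin N) (Fin N) ℝ), h2, mul_one]
    rfl
  · rw [← h, ← mul_assoc, ← mul_assoc, h2, one_mul]
    rfl
  · intro i hi
    have hdet : (Matrix.diagonal d).det = 1 := by
      rw [← h, ← Matrix.SpecialLinearGroup.coe_mul, ← Matrix.SpecialLinearGroup.coe_mul]
      exact (p * a * p⁻¹ : Matrix.SpecialLinearGroup (Fin N) ℝ).2
    rw [Matrix.det_diagonal, Finset.prod_eq_zero (Finset.mem_univ i) hi] at hdet
    exact zero_ne_one hdet

/-- In the basis that diagonalises `a`, the matrix units are eigenvectors with eigenvalues `d i / d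
j`. -/
theorem iSup_eigenspace_conjEnd
    (h : ((p * a * p⁻¹ : Matrix.SpecialLinearGroup (Fin N) ℝ) : Matrix (Fin N) (Fin N) ℝ) =
      Matrix.diagonal d) :
    ⨆ c, (conjEnd a).eigenspace c = ⊤ := by
  obtain ⟨P, P', h1, h2, h3, h4, hd⟩ := conj_diagonal_facts h
  rw [eq_top_iff]
  intro X _
  have hX : X = ∑ i, ∑ j, P' * Matrix.single i j ((P * X * P') i j) * P := by
    have : X = P' * (P * X * P') * P := by
      calc X = (P' * P) * X * (P' * P) := by rw [h2]; simp
        _ = _ := by simp only [mul_assoc]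
    conv_lhs => rw [this, Matrix.matrix_eq_sum_single (P * X * P')]
    simp only [Finset.mul_sum, Finset.sum_mul]
  rw [hX]
  refine Submodule.sum_mem _ fun i _ => Submodule.sum_mem _ fun j _ => ?_
  refine Submodule.mem_iSup_of_mem (d i / d j) ?_
  rw [Module.End.mem_eigenspace_iff, conjEnd_eq_smul_iff]
  set x := (P * X * P') i j
  have h5 : Matrix.diagonal d * Matrix.single i j x = d i • Matrix.single i j x := by
    ext k l
    by_cases hk : i = k <;> by_cases hl : j = l <;> simp [Matrix.diagonal_mul, Matrix.single, hk, hl]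
  have h6 : Matrix.single i j x * Matrix.diagonal d = d j • Matrix.single i j x := by
    ext k l
    by_cases hk : i = k <;> by_cases hl : j = l <;>
      simp [Matrix.mul_diagonal, Matrix.single, hk, hl, mul_comm]
  calc toMatrixHom G a * (P' * Matrix.single i j x * P)
      = P' * (Matrix.diagonal d * Matrix.single i j x) * P := by
        rw [← mul_assoc, ← mul_assoc, h4, mul_assoc P']
    _ = (d i / d j) • (P' * (Matrix.single i j x * Matrix.diagonal d) * P) := by
        rw [h5, h6]
        simp only [mul_smul_comm, smul_mul_assoc, smul_smul]
        rw [div_mul_cancel₀ _ (hd j)]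
    _ = _ := by
        congr 1
        simp only [mul_assoc]
        rw [h3]

/-- An eigenvector of the conjugation by `a` can be recovered linearly from its exponential. -/
theorem exists_linear_log
    (h : ((p * a * p⁻¹ : Matrix.SpecialLinearGroup (Fin N) ℝ) : Matrix (Fin N) (Fin N) ℝ) =
      Matrix.diagonal d) {lam : ℝ} (hlam : 1 < |lam|) :
    ∃ L : Matrix (Fin N) (Fin N) ℝ →ₗ[ℝ] Matrix (Fin N) (Fin N) ℝ,
      ∀ W, conjEnd a W = lam • W → L (NormedSpace.exp W) = W := by
  obtain ⟨P, P', h1, h2, h3, h4, hd⟩ := conj_diagonal_facts h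
  let π : Matrix (Fin N) (Fin N) ℝ →ₗ[ℝ] Matrix (Fin N) (Fin N) ℝ :=
    { toFun := fun A => Matrix.of fun i j => if d i = lam * d j then A i j else 0
      map_add' := fun A B => by ext i j; by_cases hij : d i = lam * d j <;> simp [hij]
      map_smul' := fun c A => by ext i j; by_cases hij : d i = lam * d j <;> simp [hij] }
  let L : Matrix (Fin N) (Fin N) ℝ →ₗ[ℝ] Matrix (Fin N) (Fin N) ℝ :=
    (LinearMap.mulLeft ℝ P' ∘ₗ LinearMap.mulRight ℝ P) ∘ₗ π ∘ₗ
      (LinearMap.mulLeft ℝ P ∘ₗ LinearMap.mulRight ℝ P')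
  have hL : ∀ X, L X = P' * π (P * X * P') * P := fun X => by simp [L, mul_assoc]
  refine ⟨L, fun W hW => ?_⟩
  -- `W ^ n` has conjugation eigenvalue `lam ^ n`. The projection `L` onto the eigenspace of `lam`
  -- therefore keeps only the linear term of the exponential series.
  have hne : ∀ n : ℕ, n ≠ 1 → lam ≠ lam ^ n := by
    intro n hn heq
    have habs : |lam| ^ 1 = |lam| ^ n := by rw [pow_one, ← abs_pow, ← heq]
    exact hn (pow_right_injective₀ (by linarith) (by linarith) habs).symm
  have hpow : ∀ n : ℕ, P * W ^ n * P' = (P * W * P') ^ n := by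
    intro n
    induction n with
    | zero => simp [h1]
    | succ n ih =>
      rw [pow_succ, pow_succ, ← ih]
      calc P * (W ^ n * W) * P' = P * W ^ n * 1 * W * P' := by simp [mul_assoc]
        _ = P * W ^ n * (P' * P) * W * P' := by rw [h2]
        _ = _ := by simp only [mul_assoc]
  have hcomm : ∀ n : ℕ, Matrix.diagonal d * (P * W ^ n * P') =
      lam ^ n • ((P * W ^ n * P') * Matrix.diagonal d) := by
    have hone : Matrix.diagonal d * (P * W * P') = lam • ((P * W * P') * Matrix.diagonal d) := by
      have := (conjEnd_eq_smul_iff a W lam).1 hW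
      calc Matrix.diagonal d * (P * W * P') = P * (toMatrixHom G a * W) * P' := by
            rw [← mul_assoc, ← mul_assoc, ← h3, mul_assoc P]
        _ = lam • (P * W * (toMatrixHom G a * P')) := by
            rw [this]; simp only [mul_smul_comm, smul_mul_assoc, mul_assoc]
        _ = _ := by rw [h4]; simp only [mul_assoc]
    intro n
    rw [hpow]
    induction n with
    | zero => simp
    | succ n ih =>
      calc Matrix.diagonal d * (P * W * P') ^ (n + 1)
          = (Matrix.diagonal d * (P * W * P') ^ n) * (P * W * P') := by
            rw [pow_succ, ← mul_assoc (Matrix.diagonal d)]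
        _ = lam ^ n • ((P * W * P') ^ n * (Matrix.diagonal d * (P * W * P'))) := by
            rw [ih, smul_mul_assoc, mul_assoc]
        _ = _ := by
            rw [hone, mul_smul_comm, smul_smul, pow_succ, pow_succ, mul_assoc ((P * W * P') ^ n)]
  have hentry : ∀ (n : ℕ) i j, d i * (P * W ^ n * P') i j =
      lam ^ n * ((P * W ^ n * P') i j * d j) := by
    intro n i j
    have := congrFun (congrFun (hcomm n) i) j
    simpa [Matrix.diagonal_mul, Matrix.mul_diagonal] using this
  have hL0 : ∀ n : ℕ, n ≠ 1 → L (W ^ n) = 0 := by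
    intro n hn
    have : π (P * W ^ n * P') = 0 := by
      ext i j
      by_cases hij : d i = lam * d j
      · have := hentry n i j
        rw [hij] at this
        have h0 : (lam - lam ^ n) * (d j * (P * W ^ n * P') i j) = 0 := by linear_combination this
        have := (mul_eq_zero.1 ((mul_eq_zero.1 h0).resolve_left (sub_ne_zero.2 (hne n hn)))).resolve_left (hd j)
        simp [π, this]
      · simp [π, hij]
    rw [hL, this]
    simp
  have hL1 : L W = W := by
    have : π (P * W * P') = P * W * P' := by
      ext i j
      by_cases hij : d i = lam * d j
      · simp [π, hij]
      · have := hentry 1 i j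
        rw [pow_one, pow_one] at this
        have h0 : (d i - lam * d j) * (P * W * P') i j = 0 := by linear_combination this
        have := (mul_eq_zero.1 h0).resolve_left (sub_ne_zero.2 hij)
        simp [π, this]
    rw [hL, this]
    calc P' * (P * W * P') * P = (P' * P) * W * (P' * P) := by simp only [mul_assoc]
      _ = W := by rw [h2]; simp
  let _ := Matrix.linftyOpNormedRing (n := Fin N) (α := ℝ)
  let _ := Matrix.linftyOpNormedAlgebra (n := Fin N) (R := ℝ) (α := ℝ)
  let _ : NormedAlgebra ℚ (Matrix (Fin N) (Fin N) ℝ) := NormedAlgebra.restrictScalars ℚ ℝ _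
  have hsum := (NormedSpace.exp_series_hasSum_exp' (𝕂 := ℝ) W).mapL (LinearMap.toContinuousLinearMap L)
  refine hsum.unique ?_
  have := hasSum_single (f := fun n : ℕ => (LinearMap.toContinuousLinearMap L)
    ((n.factorial⁻¹ : ℝ) • W ^ n)) 1 (fun n hn => by
      rw [map_smul]; simp [hL0 n hn])
  simpa [hL1] using this

variable (hG : IsClosed (G : Set (Matrix.SpecialLinearGroup (Fin N) ℝ)))

theorem coe_Ad_apply (x : lieAlg hG) :
    ((Ad hG a x : lieAlg hG) : Matrix (Fin N) (Fin N) ℝ) = conjEnd a x := by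
  rw [conjEnd_apply]
  rfl

/-- Diagonalisability passes from all matrices to the invariant subspace `𝔤`, and class `𝒜` leaves
only the eigenvalue `1` on the unit circle. -/
theorem gMinus_sup_gZero_sup_gPlus (ha : IsClassA hG a) :
    gMinus hG a ⊔ gZero hG a ⊔ gPlus hG a = ⊤ := by
  obtain ⟨p, d, h⟩ := ha.semisimple
  have hmem : ∀ x ∈ lieAlg hG, conjEnd a x ∈ lieAlg hG := fun x hx => by
    rw [← coe_Ad_apply hG ⟨x, hx⟩]
    exact (Ad hG a ⟨x, hx⟩).2
  have hAd : (conjEnd a).restrict hmem = Ad hG a := by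
    ext1 x
    exact Subtype.ext (coe_Ad_apply hG x).symm
  have htop : ⨆ c, (Ad hG a).eigenspace c = ⊤ := by
    rw [← hAd]
    exact Module.End.genEigenspace_restrict_eq_top hmem (iSup_eigenspace_conjEnd h)
  rw [eq_top_iff, ← htop]
  refine iSup_le fun c => ?_
  by_cases hc : (Ad hG a).HasEigenvalue c
  · rcases lt_trichotomy |c| 1 with h1 | h1 | h1
    · exact (le_iSup₂ (f := fun c (_ : |c| < 1) => (Ad hG a).eigenspace c) c h1).trans
        (le_sup_left.trans le_sup_left)
    · rw [ha.eq_one c hc h1]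
      exact le_sup_right.trans le_sup_left
    · exact (le_iSup₂ (f := fun c (_ : 1 < |c|) => (Ad hG a).eigenspace c) c h1).trans le_sup_right
  · rw [Module.End.hasEigenvalue_iff, not_not] at hc
    rw [hc]
    exact bot_le

theorem abs_lt_one_of_mem_gMinus {c : ℝ} {x : lieAlg hG} (hx : x ∈ gMinus hG a) (hx0 : x ≠ 0)
    (hc : Ad hG a x = c • x) : |c| < 1 := by
  by_contra hcon
  have hd := (Module.End.eigenspaces_iSupIndep (Ad hG a)) c
  refine hx0 (Submodule.disjoint_def.1 hd x (Module.End.mem_eigenspace_iff.2 hc) ?_)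
  refine (iSup₂_le fun c' hc' => ?_ : gMinus hG a ≤ _) hx
  exact le_iSup₂_of_le c' (fun h => hcon (h ▸ hc')) le_rfl

/-- Otherwise an eigenvector for `lam` would lie in a sum of other eigenspaces, against their
independence. -/
theorem one_lt_abs_of_gPlus_eq {lam : ℝ} (hlam : (Ad hG a).HasEigenvalue lam)
    (hplus : gPlus hG a = (Ad hG a).eigenspace lam) : 1 < |lam| := by
  by_contra hcon
  obtain ⟨x, hx⟩ := hlam.exists_hasEigenvector
  have hd := (Module.End.eigenspaces_iSupIndep (Ad hG a)) lam
  refine hx.2 (Submodule.disjoint_def.1 hd x hx.1 ?_)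
  have hxp : x ∈ gPlus hG a := hplus.symm ▸ hx.1
  refine (iSup₂_le fun c' hc' => ?_ : gPlus hG a ≤ _) hxp
  exact le_iSup₂_of_le c' (fun h => hcon (h ▸ hc')) le_rfl

theorem expG_Ad (x : lieAlg hG) : expG hG (Ad hG a x) = a * expG hG x * a⁻¹ := by
  refine (isClosedEmbedding_toMatrixHom hG).injective ?_
  rw [map_mul, map_mul]
  have hinv : toMatrixHom G a⁻¹ = (toMatrixHom G a)⁻¹ := by
    refine (Matrix.inv_eq_right_inv ?_).symm
    rw [← map_mul, mul_inv_cancel, map_one]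
  have hu : IsUnit (toMatrixHom G a) :=
    ⟨⟨toMatrixHom G a, toMatrixHom G a⁻¹, by rw [← map_mul, mul_inv_cancel, map_one],
      by rw [← map_mul, inv_mul_cancel, map_one]⟩, rfl⟩
  have := Matrix.exp_conj (toMatrixHom G a) (x : Matrix (Fin N) (Fin N) ℝ) hu
  rw [hinv]
  refine Eq.trans ?_ this
  rw [← hinv, ← conjEnd_apply, ← coe_Ad_apply hG]
  rfl

theorem expG_pow_Ad (x : lieAlg hG) (l : ℕ) :
    expG hG ((Ad hG a ^ l) x) = a ^ l * expG hG x * (a ^ l)⁻¹ := by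
  induction l with
  | zero => simp
  | succ l ih =>
    rw [pow_succ', Module.End.mul_apply, expG_Ad, ih, pow_succ']
    group

end Adjoint

/-! ### Tubes around the identity -/

theorem LinearMap.exists_norm_le {E F : Type*} [NormedAddCommGroup E] [NormedSpace ℝ E]
    [FiniteDimensional ℝ E] [NormedAddCommGroup F] [NormedSpace ℝ F] (f : E →ₗ[ℝ] F) :
    ∃ C > 0, ∀ x, ‖f x‖ ≤ C * ‖x‖ :=
  (LinearMap.toContinuousLinearMap f).bound

section Tubes

variable {N : ℕ} {G : Subgroup (Matrix.SpecialLinearGroup (Fin N) ℝ)}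
  {hG : IsClosed (G : Set (Matrix.SpecialLinearGroup (Fin N) ℝ))} {a : G} {nm nz np : ℕ}
  (bm : Module.Basis (Fin nm) ℝ (gMinus hG a)) (b0 : Module.Basis (Fin nz) ℝ (gZero hG a))
  (bp : Module.Basis (Fin np) ℝ (gPlus hG a))

/-- The linear parametrisation of a subspace of the Lie algebra by coordinates. -/
noncomputable def coordMap {V : Submodule ℝ (lieAlg hG)} {n : ℕ} (b : Module.Basis (Fin n) ℝ V) :
    (Fin n → ℝ) →ₗ[ℝ] lieAlg hG :=
  V.subtype ∘ₗ b.equivFun.symm.toLinearMap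

theorem mem_supBall_zero_iff {V : Submodule ℝ (lieAlg hG)} {n : ℕ}
    (b : Module.Basis (Fin n) ℝ V) (z : V) (r : ℝ) :
    z ∈ supBall b 0 r ↔ b.equivFun z ∈ Metric.ball 0 r := by
  have h : z - 0 = z := sub_zero z
  rw [supBall, Set.mem_ofPred_eq, h, mem_ball_zero_iff]

theorem coordMap_apply {V : Submodule ℝ (lieAlg hG)} {n : ℕ} (b : Module.Basis (Fin n) ℝ V)
    (x : Fin n → ℝ) : coordMap b x = ∑ i, x i • (b i : lieAlg hG) := by
  simp [coordMap, Module.Basis.equivFun_symm_apply]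

theorem range_coordMap {V : Submodule ℝ (lieAlg hG)} {n : ℕ} (b : Module.Basis (Fin n) ℝ V) :
    LinearMap.range (coordMap b) = V := by
  rw [coordMap, LinearMap.range_comp_of_range_eq_top _ (LinearEquiv.range _), Submodule.range_subtype]

theorem Ad_pow_coordMap {V : Submodule ℝ (lieAlg hG)} {n : ℕ} (b : Module.Basis (Fin n) ℝ V)
    {c : Fin n → ℝ} (hc : ∀ i, Ad hG a (b i) = c i • (b i : lieAlg hG)) (l : ℕ) (x : Fin n → ℝ) :
    (Ad hG a ^ l) (coordMap b x) = coordMap b (fun i => c i ^ l * x i) := by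
  have hb : ∀ i, (Ad hG a ^ l) (b i) = c i ^ l • (b i : lieAlg hG) := by
    intro i
    induction l with
    | zero => simp
    | succ l ih => rw [pow_succ', Module.End.mul_apply, ih, map_smul, hc, smul_smul, pow_succ]
  rw [coordMap_apply, coordMap_apply, map_sum]
  refine Finset.sum_congr rfl fun i _ => ?_
  rw [map_smul, hb, smul_smul, mul_comm]

/-- The product `exp(x) exp(y) exp(z)`, in coordinates. -/
noncomputable def tubeMap (q : (Fin nm → ℝ) × (Fin nz → ℝ) × (Fin np → ℝ)) : G :=
  expG hG (coordMap bm q.1) * expG hG (coordMap b0 q.2.1) * expG hG (coordMap bp q.2.2)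

theorem tube_eq_image (s r : ℝ) :
    tube bm b0 bp s r 0 =
      tubeMap bm b0 bp '' (Metric.ball 0 s ×ˢ Metric.ball 0 s ×ˢ Metric.ball 0 r) := by
  ext g
  constructor
  · rintro ⟨x, y, z, hx, hy, hz, rfl⟩
    refine ⟨(bm.equivFun x, b0.equivFun y, bp.equivFun z), ?_, ?_⟩
    · exact ⟨(mem_supBall_zero_iff bm x s).1 hx, (mem_supBall_zero_iff b0 y s).1 hy,
        (mem_supBall_zero_iff bp z r).1 hz⟩
    · simp [tubeMap, coordMap]
  · rintro ⟨⟨x, y, z⟩, ⟨hx, hy, hz⟩, rfl⟩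
    exact ⟨bm.equivFun.symm x, b0.equivFun.symm y, bp.equivFun.symm z,
      (mem_supBall_zero_iff bm _ s).2 (by rwa [LinearEquiv.apply_symm_apply]),
      (mem_supBall_zero_iff b0 _ s).2 (by rwa [LinearEquiv.apply_symm_apply]),
      (mem_supBall_zero_iff bp _ r).2 (by rwa [LinearEquiv.apply_symm_apply]), rfl⟩

theorem continuous_expG_coordMap {V : Submodule ℝ (lieAlg hG)} {n : ℕ}
    (b : Module.Basis (Fin n) ℝ V) : Continuous fun x => expG hG (coordMap b x) := by
  let _ := Matrix.linftyOpNormedRing (n := Fin N) (α := ℝ)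
  let _ := Matrix.linftyOpNormedAlgebra (n := Fin N) (R := ℝ) (α := ℝ)
  let _ : NormedAlgebra ℚ (Matrix (Fin N) (Fin N) ℝ) := NormedAlgebra.restrictScalars ℚ ℝ _
  rw [(isClosedEmbedding_toMatrixHom hG).isInducing.continuous_iff]
  exact NormedSpace.exp_continuous.comp
    (LinearMap.continuous_of_finiteDimensional ((lieAlg hG).subtype ∘ₗ coordMap b))

theorem continuous_tubeMap : Continuous (tubeMap bm b0 bp) :=
  (((continuous_expG_coordMap bm).comp continuous_fst).mul
    ((continuous_expG_coordMap b0).comp (continuous_fst.comp continuous_snd))).mul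
    ((continuous_expG_coordMap bp).comp (continuous_snd.comp continuous_snd))

theorem expG_zero : expG hG 0 = 1 :=
  (isClosedEmbedding_toMatrixHom hG).injective (by
    rw [map_one]
    exact NormedSpace.exp_zero)

theorem tubeMap_zero : tubeMap bm b0 bp 0 = 1 := by
  simp [tubeMap, expG_zero]

/-- In these coordinates conjugation is linear and diagonal: it scales each stable coordinate, fixes
the neutral ones and multiplies all unstable ones by the same scalar. -/
theorem conj_tubeMap {c : Fin nm → ℝ} (hc : ∀ i, Ad hG a (bm i) = c i • (bm i : lieAlg hG))
    {lam : ℝ} (hplus : gPlus hG a = (Ad hG a).eigenspace lam) (l : ℕ)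
    (x : Fin nm → ℝ) (y : Fin nz → ℝ) (z : Fin np → ℝ) :
    a ^ l * tubeMap bm b0 bp (x, y, z) * (a ^ l)⁻¹ =
      tubeMap bm b0 bp (fun i => c i ^ l * x i, y, lam ^ l • z) := by
  have h0 : ∀ i, Ad hG a (b0 i) = (1 : ℝ) • (b0 i : lieAlg hG) := fun i =>
    Module.End.mem_eigenspace_iff.1 (b0 i).2
  have hp : ∀ i, Ad hG a (bp i) = lam • (bp i : lieAlg hG) := fun i => by
    have h : (bp i : lieAlg hG) ∈ (Ad hG a).eigenspace lam := by
      rw [← hplus]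
      exact (bp i).2
    exact Module.End.mem_eigenspace_iff.1 h
  have e1 := (expG_pow_Ad (a := a) hG (coordMap bm x) l).symm
  have e2 := (expG_pow_Ad (a := a) hG (coordMap b0 y) l).symm
  have e3 := (expG_pow_Ad (a := a) hG (coordMap bp z) l).symm
  rw [Ad_pow_coordMap bm hc] at e1
  rw [Ad_pow_coordMap b0 (c := fun _ => 1) h0] at e2
  rw [Ad_pow_coordMap bp (c := fun _ => lam) hp] at e3
  simp only [one_pow, one_mul] at e2
  have e3' : (fun i => lam ^ l * z i) = lam ^ l • z := rfl
  rw [e3'] at e3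
  simp only [tubeMap]
  conv_rhs => rw [← e1, ← e2, ← e3]
  group

theorem tube_mono (s : ℝ) {r r' : ℝ} (h : r ≤ r') :
    tube bm b0 bp s r 0 ⊆ tube bm b0 bp s r' 0 := by
  rintro _ ⟨x, y, z, hx, hy, hz, rfl⟩
  exact ⟨x, y, z, hx, hy, lt_of_lt_of_le hz h, rfl⟩

theorem tube_mem_nhds (ha : IsClassA hG a) {s r : ℝ} (hs : 0 < s) (hr : 0 < r) :
    tube bm b0 bp s r 0 ∈ 𝓝 1 := by
  rw [tube_eq_image]
  refine exp_mul_exp_mul_exp_mem_nhds hG _ _ _ ?_ ?_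
  · rw [range_coordMap, range_coordMap, range_coordMap, gMinus_sup_gZero_sup_gPlus hG ha]
  · exact prod_mem_nhds (Metric.ball_mem_nhds _ hs)
      (prod_mem_nhds (Metric.ball_mem_nhds _ hs) (Metric.ball_mem_nhds _ hr))

theorem measurableSet_image_tube {Γ : Subgroup G} [T2Space (CosetSpace Γ)] (s r : ℝ)
    (x : CosetSpace Γ) : MeasurableSet ((fun g : G => g • x) '' tube bm b0 bp s r 0) := by
  set B : Set ((Fin nm → ℝ) × (Fin nz → ℝ) × (Fin np → ℝ)) :=
    Metric.ball 0 s ×ˢ Metric.ball 0 s ×ˢ Metric.ball 0 r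
  have hB : IsOpen B := Metric.isOpen_ball.prod (Metric.isOpen_ball.prod Metric.isOpen_ball)
  have hloc : LocallyCompactSpace B := hB.locallyCompactSpace
  -- Continuous images of σ-compact sets are σ-compact, hence Borel in a Hausdorff space.
  have hσ : IsSigmaCompact B := isSigmaCompact_iff_sigmaCompactSpace.2 inferInstance
  rw [tube_eq_image]
  obtain ⟨K, hK, hKB⟩ := (hσ.image (continuous_tubeMap bm b0 bp)).image
    (CosetSpace.continuous_smul_left Γ x)
  rw [← hKB]
  exact MeasurableSet.iUnion fun n => (hK n).isClosed.measurableSet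

theorem norm_mul_pow_le {n : ℕ} {c : Fin n → ℝ} (hc : ∀ i, |c i| ≤ 1) (l : ℕ) (x : Fin n → ℝ) :
    ‖fun i => c i ^ l * x i‖ ≤ ‖x‖ := by
  refine (pi_norm_le_iff_of_nonneg (norm_nonneg x)).2 fun i => ?_
  rw [norm_mul, norm_pow]
  exact (mul_le_of_le_one_left (norm_nonneg _) (pow_le_one₀ (norm_nonneg _) (hc i))).trans
    (norm_le_pi_norm x i)

theorem exists_conj_tube_subset {c : Fin nm → ℝ}
    (hc : ∀ i, Ad hG a (bm i) = c i • (bm i : lieAlg hG)) (hc1 : ∀ i, |c i| ≤ 1)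
    {lam t : ℝ} (hplus : gPlus hG a = (Ad hG a).eigenspace lam) (ht : |lam| = Real.exp t)
    {V : Set G} (hV : V ∈ 𝓝 1) :
    ∃ s₁ > 0, ∀ s, 0 < s → s ≤ s₁ → ∀ l : ℕ, ∀ f ∈ tube bm b0 bp s (s * Real.exp (-t * l)) 0,
      a ^ l * f * (a ^ l)⁻¹ ∈ V := by
  have hpre := (continuous_tubeMap bm b0 bp).continuousAt.preimage_mem_nhds
    (show V ∈ 𝓝 (tubeMap bm b0 bp 0) by rwa [tubeMap_zero])
  obtain ⟨s₁, hs₁, hball⟩ := Metric.mem_nhds_iff.1 hpre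
  refine ⟨s₁, hs₁, fun s _ hss l f hf => ?_⟩
  rw [tube_eq_image] at hf
  obtain ⟨⟨x, y, z⟩, ⟨hx, hy, hz⟩, rfl⟩ := hf
  rw [conj_tubeMap bm b0 bp hc hplus]
  simp only [mem_ball_zero_iff] at hx hy hz
  refine hball ?_
  rw [mem_ball_zero_iff]
  have hz' : ‖lam ^ l • z‖ < s := by
    rw [norm_smul, norm_pow, Real.norm_eq_abs, ht, ← Real.exp_nat_mul]
    calc Real.exp (l * t) * ‖z‖ < Real.exp (l * t) * (s * Real.exp (-t * l)) := by gcongr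
      _ = s * (Real.exp (l * t) * Real.exp (-t * l)) := by ring
      _ = s := by rw [← Real.exp_add]; ring_nf; simp
  exact max_lt (((norm_mul_pow_le hc1 l x).trans_lt hx).trans_le hss)
    (max_lt (lt_of_lt_of_le hy hss) (hz'.trans_le hss))

/-- Writing `h = exp x exp y exp z`, a bound on its conjugate bounds `exp(lam^k z)`, since the
stable and neutral factors range over a compact set. The linear logarithm then bounds `lam^k z`.
Boundedness alone is used, so `V` can be a norm ball of fixed size. -/
theorem exists_mem_tube_of_conj {c : Fin nm → ℝ} (ha : IsClassA hG a)
    (hc : ∀ i, Ad hG a (bm i) = c i • (bm i : lieAlg hG)) (hc1 : ∀ i, |c i| ≤ 1)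
    {lam t : ℝ} (hlam : 1 < |lam|) (hplus : gPlus hG a = (Ad hG a).eigenspace lam)
    (ht : |lam| = Real.exp t) {s : ℝ} (hs : 0 < s) :
    ∃ C > 0, ∃ E ∈ 𝓝 (1 : G), ∃ V ∈ 𝓝 (1 : G), ∀ h ∈ E, ∀ k : ℕ,
      a ^ k * h * (a ^ k)⁻¹ ∈ V → h ∈ tube bm b0 bp s (C * Real.exp (-t * k)) 0 := by
  let _ := Matrix.linftyOpNormedRing (n := Fin N) (α := ℝ)
  let _ := Matrix.linftyOpNormedAlgebra (n := Fin N) (R := ℝ) (α := ℝ)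
  have hι := (isClosedEmbedding_toMatrixHom hG).continuous
  obtain ⟨p, d, hpd⟩ := ha.semisimple
  obtain ⟨L, hL⟩ := exists_linear_log hpd hlam
  -- the coordinates in `𝔤₊` are controlled by the exponential
  obtain ⟨D, hD0, hD⟩ : ∃ D > 0, ∀ z : Fin np → ℝ,
      ‖z‖ ≤ D * ‖toMatrixHom G (expG hG (coordMap bp z))‖ := by
    let R : (Fin np → ℝ) →ₗ[ℝ] Matrix (Fin N) (Fin N) ℝ := (lieAlg hG).subtype ∘ₗ coordMap bp
    have hR : LinearMap.ker R = ⊥ := by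
      rw [LinearMap.ker_eq_bot]
      exact Subtype.val_injective.comp
        (Subtype.val_injective.comp bp.equivFun.symm.injective)
    obtain ⟨R', hR'⟩ := R.exists_leftInverse_of_injective hR
    obtain ⟨D, hD0, hD⟩ := LinearMap.exists_norm_le (R' ∘ₗ L)
    refine ⟨D, hD0, fun z => ?_⟩
    have hz : (R' ∘ₗ L) (toMatrixHom G (expG hG (coordMap bp z))) = z := by
      have hW : conjEnd a (R z) = lam • R z := by
        have h1 : coordMap bp z ∈ (Ad hG a).eigenspace lam := by
          exact hplus.le ((range_coordMap bp).le (LinearMap.mem_range_self _ z))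
        have h2 := congrArg Subtype.val (Module.End.mem_eigenspace_iff.1 h1)
        rw [coe_Ad_apply] at h2
        exact h2
      have h3 : L (toMatrixHom G (expG hG (coordMap bp z))) = R z := hL _ hW
      show R' (L _) = z
      rw [h3]
      exact LinearMap.congr_fun hR' z
    conv_lhs => rw [← hz]
    exact hD _
  obtain ⟨B, hB⟩ : ∃ B, ∀ x ∈ Metric.closedBall (0 : Fin nm → ℝ) s,
      ∀ y ∈ Metric.closedBall (0 : Fin nz → ℝ) s,
        ‖toMatrixHom G (tubeMap bm b0 bp (x, y, 0))⁻¹‖ ≤ B := by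
    have hcomp := ((isCompact_closedBall (0 : Fin nm → ℝ) s).prod
      (isCompact_closedBall (0 : Fin nz → ℝ) s))
    have hcont : Continuous fun q : (Fin nm → ℝ) × (Fin nz → ℝ) =>
        toMatrixHom G (tubeMap bm b0 bp (q.1, q.2, 0))⁻¹ := by
      refine hι.comp (Continuous.inv ((continuous_tubeMap bm b0 bp).comp ?_))
      fun_prop
    obtain ⟨B, hB⟩ := hcomp.exists_bound_of_continuousOn hcont.continuousOn
    exact ⟨B, fun x hx y hy => hB (x, y) ⟨hx, hy⟩⟩
  have hB0 : 0 ≤ B := (norm_nonneg _).trans (hB 0 (by simp [hs.le]) 0 (by simp [hs.le]))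
  set e := ‖(1 : Matrix (Fin N) (Fin N) ℝ)‖
  have he : 0 ≤ e := norm_nonneg _
  refine ⟨D * (B * (e + 1)) + 1, by positivity, tube bm b0 bp s s 0,
    tube_mem_nhds bm b0 bp ha hs hs, {g | ‖toMatrixHom G g‖ < e + 1}, ?_, ?_⟩
  · refine (isOpen_lt (continuous_norm.comp hι) continuous_const).mem_nhds ?_
    show ‖toMatrixHom G 1‖ < e + 1
    rw [map_one]
    exact lt_add_one _
  intro h hh k hk
  rw [tube_eq_image] at hh ⊢
  obtain ⟨⟨x, y, z⟩, ⟨hx, hy, hz⟩, rfl⟩ := hh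
  refine ⟨(x, y, z), ⟨hx, hy, ?_⟩, rfl⟩
  rw [conj_tubeMap bm b0 bp hc hplus] at hk
  simp only [mem_ball_zero_iff] at hx hy hz ⊢
  set x' : Fin nm → ℝ := fun i => c i ^ k * x i
  have hx' : x' ∈ Metric.closedBall (0 : Fin nm → ℝ) s := by
    simpa using (norm_mul_pow_le hc1 k x).trans hx.le
  have hy' : y ∈ Metric.closedBall (0 : Fin nz → ℝ) s := by simpa using hy.le
  have hfac : expG hG (coordMap bp (lam ^ k • z)) =
      (tubeMap bm b0 bp (x', y, 0))⁻¹ * tubeMap bm b0 bp (x', y, lam ^ k • z) := by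
    simp only [tubeMap, map_zero, expG_zero]
    group
  have hbd : ‖toMatrixHom G (expG hG (coordMap bp (lam ^ k • z)))‖ ≤ B * (e + 1) := by
    rw [hfac, map_mul]
    have hk' : ‖toMatrixHom G (tubeMap bm b0 bp (x', y, lam ^ k • z))‖ < e + 1 := hk
    refine (norm_mul_le _ _).trans ?_
    gcongr
    exact hB x' hx' y hy'
  have hzk : ‖lam ^ k • z‖ < D * (B * (e + 1)) + 1 := by
    have := hD (lam ^ k • z)
    nlinarith
  rw [norm_smul, norm_pow, Real.norm_eq_abs, ht, ← Real.exp_nat_mul] at hzk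
  have hpos := Real.exp_pos (-t * k)
  calc ‖z‖ = Real.exp (k * t) * ‖z‖ * Real.exp (-t * k) := by
        rw [mul_right_comm, ← Real.exp_add]; ring_nf; simp
    _ < _ := by gcongr

end Tubes

/-! ### The entropy of the limit -/

theorem cesaroAverage_apply_le {X : Type*} [MeasurableSpace X] {T : X → X} {μ : Measure X}
    {O : Set X} {B : ℝ≥0∞} (h : ∀ l : ℕ, μ.map T^[l] O ≤ B) (k : ℕ) :
    cesaroAverage T μ k O ≤ B := by
  rw [cesaroAverage, Measure.smul_apply, Measure.finsetSum_apply, smul_eq_mul]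
  rcases Nat.eq_zero_or_pos k with rfl | hk
  -- For `k = 0` the average is `∞ • 0 = 0`.
  · simp
  · calc _ ≤ (k : ℝ≥0∞)⁻¹ * ∑ _l ∈ Finset.range k, B := by
          gcongr with l _
          exact h l
      _ = B := by
        rw [Finset.sum_const, Finset.card_range, nsmul_eq_mul, ← mul_assoc,
          ENNReal.inv_mul_cancel (by exact_mod_cast hk.ne') (by simp), one_mul]

theorem isOpen_bowenSet {G : Type*} [Group G] [TopologicalSpace G] [IsTopologicalGroup G] (a : G)
    {U : Set G} (hU : IsOpen U) (n : ℕ) : IsOpen (bowenSet a U n) := by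
  have : bowenSet a U n = ⋂ k ∈ Finset.range (n + 1), (fun g => a ^ k * g * (a ^ k)⁻¹) ⁻¹' U := by
    ext g
    simp [bowenSet]
  rw [this]
  exact isOpen_biInter_finset fun k _ => hU.preimage (by fun_prop)

/-- If the Bowen balls of order `n` with centre in a compact set have measure `O(θⁿ)`, for each
compact set, then the entropy is at least `-log θ`. -/
theorem measureEntropy_ge_of_bowen_le {G : Type*} [Group G] [TopologicalSpace G]
    [IsTopologicalGroup G] {Γ : Subgroup G} [DiscreteTopology Γ] [T2Space (CosetSpace Γ)] {a : G}
    {ν : Measure (CosetSpace Γ)} [IsProbabilityMeasure ν] [ν.InnerRegular]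
    (hT : MeasurePreserving (fun x : CosetSpace Γ => a • x) ν ν)
    {K : ℕ} (hK : ∀ V ∈ 𝓝 (1 : G), ∃ U : Set G, IsOpen U ∧ (1 : G) ∈ U ∧ U ⊆ V ∧
      ∃ D : Fin K → Set G, (∀ g ∈ U, ∃ j, a * g * a⁻¹ ∈ D j) ∧
        ∀ j, ∀ g ∈ D j, ∀ g' ∈ D j, g' * g⁻¹ ∈ U)
    {θ : ℝ} (hθ : 0 < θ)
    (hbowen : ∀ Q : Set (CosetSpace Γ), IsCompact Q → ∃ V ∈ 𝓝 (1 : G), ∀ U ⊆ V, IsOpen U →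
      ∃ C : ℝ, 1 ≤ C ∧ ∀ n, ∀ z ∈ Q,
        ν ((fun g : G => g • z) '' bowenSet a U n) ≤ ENNReal.ofReal (C * θ ^ n)) :
    ENNReal.ofReal (-Real.log θ) ≤ measureEntropy (fun x : CosetSpace Γ => a • x) ν := by
  -- Fixed before `Q` is chosen, so the error `ν(Qᶜ) log K'` tends to `0`.
  set K' : ℝ := max K (max 1 θ⁻¹)
  have hK1 : 1 ≤ K' := (le_max_left _ _).trans (le_max_right _ _)
  have hK0 : 0 < K' := by linarith
  have hKθ : 1 ≤ K' * θ := by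
    calc (1 : ℝ) = θ⁻¹ * θ := by field_simp
      _ ≤ K' * θ := by gcongr; exact (le_max_right _ _).trans (le_max_right _ _)
  have key : ∀ n : ℕ, ENNReal.ofReal (-Real.log θ - Real.log K' * ((n : ℝ) + 1)⁻¹) ≤
      measureEntropy (fun x : CosetSpace Γ => a • x) ν := by
    intro n
    have hn : (0 : ℝ) < ((n : ℝ) + 1)⁻¹ := by positivity
    obtain ⟨Q, hQ, hνQ⟩ : ∃ Q : Set (CosetSpace Γ), IsCompact Q ∧ ν.real Qᶜ ≤ ((n : ℝ) + 1)⁻¹ := by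
      have h1 : 1 - ENNReal.ofReal ((n : ℝ) + 1)⁻¹ < ν Set.univ := by
        rw [measure_univ]
        exact ENNReal.sub_lt_self (by simp) (by simp) (by simpa using hn)
      obtain ⟨Q, -, hQ, hlt⟩ := MeasurableSet.univ.exists_lt_isCompact h1
      refine ⟨Q, hQ, ?_⟩
      rw [Measure.real, measure_compl hQ.measurableSet (measure_ne_top _ _), measure_univ]
      refine ENNReal.toReal_le_of_le_ofReal hn.le ?_
      rw [tsub_le_iff_left]
      exact (tsub_le_iff_right.1 hlt.le)
    obtain ⟨V₁, hV₁, hbound⟩ := hbowen Q hQ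
    obtain ⟨V₂, hV₂, hinj⟩ := CosetSpace.exists_nhds_injective Γ hQ
    -- One step of expansion of `U` must stay inside the injectivity neighbourhood.
    have hV₃ : (fun g => a * g * a⁻¹) ⁻¹' V₂ ∈ 𝓝 (1 : G) := by
      have hcont : Continuous fun g : G => a * g * a⁻¹ := by fun_prop
      exact hcont.continuousAt.preimage_mem_nhds (by simpa using hV₂)
    obtain ⟨U, hUo, hU1, hUV, D, hD, hDU⟩ := hK _ (inter_mem hV₁ (inter_mem hV₂ hV₃))
    obtain ⟨C, hC1, hC⟩ := hbound U (fun g hg => (hUV hg).1) hUo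
    have hne : Nonempty (CosetSpace Γ) := ⟨CosetSpace.mk Γ 1⟩
    obtain ⟨ξ, R, hξm, hξR, hξQ, hξ⟩ := exists_finite_labelling (CosetSpace.isOpenMap_smul_left Γ)
      hQ hQ.measurableSet (hUo.mem_nhds hU1)
    have hcyl := fun m => measure_cylinder_le (ν := ν) hθ hC1 hT hξm
      (fun g hg => (hUV hg).2.1) (fun g hg => (hUV hg).2.2) hinj hD hDU
      (fun x hx => (hξQ x).1 hx) hξ hC (le_max_left _ _) hK1 hKθ m
    have hent := entropyOfPartition_ge hT hξm hξR (by positivity) hK0 hθ hcyl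
    have h0 : ξ ⁻¹' {0} = Qᶜ := by
      ext x
      have := hξQ x
      simp only [Set.mem_preimage, Set.mem_singleton_iff, Set.mem_compl_iff]
      tauto
    calc _ ≤ ENNReal.ofReal (-Real.log θ - Real.log K' * ν.real (ξ ⁻¹' {0})) := by
          refine ENNReal.ofReal_le_ofReal ?_
          rw [h0]
          have := Real.log_nonneg hK1
          gcongr
      _ ≤ entropyOfPartition (fun x : CosetSpace Γ => a • x) ν ξ := hent
      _ ≤ _ := by
          have hfin : partitionEntropy ν ξ < ∞ := partitionEntropy_lt_top_of_bounded hξR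
          refine le_iSup_of_le ξ (le_iSup_of_le hξm ?_)
          exact le_iSup (fun _ : partitionEntropy ν ξ < ∞ =>
            entropyOfPartition (fun x : CosetSpace Γ => a • x) ν ξ) hfin
  refine le_of_tendsto' (f := fun n : ℕ =>
    ENNReal.ofReal (-Real.log θ - Real.log K' * ((n : ℝ) + 1)⁻¹)) (x := atTop) ?_ key
  refine ENNReal.tendsto_ofReal ?_
  have h1 : Tendsto (fun n : ℕ => ((n : ℝ) + 1)⁻¹) atTop (𝓝 0) := by
    simpa only [one_div] using tendsto_one_div_add_atTop_nhds_zero_nat (𝕜 := ℝ)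
  simpa using tendsto_const_nhds.sub (h1.const_mul (Real.log K'))

theorem mainTheorem4 {N : ℕ} (G : Subgroup (Matrix.SpecialLinearGroup (Fin N) ℝ))
    (hG : IsClosed (G : Set (Matrix.SpecialLinearGroup (Fin N) ℝ)))
    (hconn : IsConnected (G : Set (Matrix.SpecialLinearGroup (Fin N) ℝ)))
    (Γ : Subgroup G) (hΓ : IsLattice Γ)
    (a : G) (ha : IsClassA hG a)
    (habel : ∀ g ∈ unstableHorospherical a, ∀ h ∈ unstableHorospherical a, g * h = h * g)
    (lam t : ℝ) (hlam : (Ad hG a).HasEigenvalue lam)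
    (hplus : gPlus hG a = (Ad hG a).eigenspace lam) (ht : |lam| = Real.exp t)
    {nm nz np : ℕ}
    (bm : Module.Basis (Fin nm) ℝ (gMinus hG a))
    (hbm : ∀ i, ∃ c : ℝ, Ad hG a (bm i) = c • (bm i : lieAlg hG))
    (b0 : Module.Basis (Fin nz) ℝ (gZero hG a))
    (bp : Module.Basis (Fin np) ℝ (gPlus hG a))
    (μ : Measure (CosetSpace Γ)) [IsProbabilityMeasure μ]
    (κ : ℝ) (hκ : 0 < κ) (hμ : HasLocalDimension bm b0 bp μ κ)
    (ρ : Measure (CosetSpace Γ)) [IsFiniteMeasureOnCompacts ρ]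
    (hρ : IsWeakStarLimitPoint ρ (cesaroAverage (fun x => a • x) μ))
    (hpos : 0 < ρ Set.univ) :
    IsProbabilityMeasure ((ρ Set.univ)⁻¹ • ρ) ∧
      MeasurePreserving (fun x : CosetSpace Γ => a • x)
        ((ρ Set.univ)⁻¹ • ρ) ((ρ Set.univ)⁻¹ • ρ) ∧
      ENNReal.ofReal (κ * t) ≤
        measureEntropy (fun x : CosetSpace Γ => a • x) ((ρ Set.univ)⁻¹ • ρ) := by
  have hdisc : DiscreteTopology Γ := hΓ.1
  have hemb := isClosedEmbedding_toMatrixHom hG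
  have hlcM : LocallyCompactSpace (Matrix (Fin N) (Fin N) ℝ) :=
    inferInstanceAs (LocallyCompactSpace (Fin N → Fin N → ℝ))
  have hscM : SecondCountableTopology (Matrix (Fin N) (Fin N) ℝ) :=
    inferInstanceAs (SecondCountableTopology (Fin N → Fin N → ℝ))
  have hlcG : LocallyCompactSpace G := hemb.locallyCompactSpace
  have hscG : SecondCountableTopology G := hemb.isEmbedding.secondCountableTopology
  have hT2 : T2Space (CosetSpace Γ) := CosetSpace.t2Space Γ
  have hlc : LocallyCompactSpace (CosetSpace Γ) := CosetSpace.locallyCompactSpace Γ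
  have hsc : SecondCountableTopology (CosetSpace Γ) := CosetSpace.secondCountableTopology Γ
  let _ := TopologicalSpace.metrizableSpaceMetric (CosetSpace Γ)
  have hreg : ρ.Regular := inferInstance
  have hρ1 : ρ Set.univ ≤ 1 := by
    refine hρ.measure_le_of_isOpen isOpen_univ ENNReal.one_ne_top fun k => ?_
    refine cesaroAverage_apply_le (fun l => ?_) k
    rw [Measure.map_apply (((continuous_const_smul a).iterate l).measurable) MeasurableSet.univ]
    exact prob_le_one
  have hρtop : ρ Set.univ ≠ ∞ := ne_top_of_le_ne_top ENNReal.one_ne_top hρ1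
  have hfin : IsFiniteMeasure ρ := ⟨hρtop.lt_top⟩
  have hprob : IsProbabilityMeasure ((ρ Set.univ)⁻¹ • ρ) := ⟨by
    rw [Measure.smul_apply, smul_eq_mul, ENNReal.inv_mul_cancel hpos.ne' hρtop]⟩
  have hmap : ρ.map (fun x => a • x) = ρ :=
    HomDyn.IsWeakStarLimitPoint.map_eq (T := Homeomorph.smul a) hρ
  have hMP : MeasurePreserving (fun x : CosetSpace Γ => a • x)
      ((ρ Set.univ)⁻¹ • ρ) ((ρ Set.univ)⁻¹ • ρ) :=
    ⟨(continuous_const_smul a).measurable, by rw [Measure.map_smul, hmap]⟩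
  refine ⟨hprob, hMP, ?_⟩
  have hlam1 := one_lt_abs_of_gPlus_eq hG hlam hplus
  have ht0 : 0 ≤ t := by
    rw [ht] at hlam1
    exact (Real.one_lt_exp_iff.1 hlam1).le
  choose c hc using hbm
  have hc1 : ∀ i, |c i| ≤ 1 := fun i =>
    (abs_lt_one_of_mem_gMinus hG (bm i).2
      (fun h => bm.ne_zero i (Subtype.ext h)) (hc i)).le
  obtain ⟨hsupp, s₀, hs₀, l₀, hl₀, C₀, hdim⟩ := hμ
  obtain ⟨K, hK⟩ : ∃ K : ℕ, ∀ V ∈ 𝓝 (1 : G), ∃ U : Set G, IsOpen U ∧ (1 : G) ∈ U ∧ U ⊆ V ∧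
      ∃ D : Fin K → Set G, (∀ g ∈ U, ∃ j, a * g * a⁻¹ ∈ D j) ∧
        ∀ j, ∀ g ∈ D j, ∀ g' ∈ D j, g' * g⁻¹ ∈ U := by
    let _ := Matrix.linftyOpNormedRing (n := Fin N) (α := ℝ)
    let _ := Matrix.linftyOpNormedAlgebra (n := Fin N) (R := ℝ) (α := ℝ)
    have hproper : ProperSpace (Matrix (Fin N) (Fin N) ℝ) := FiniteDimensional.proper ℝ _
    exact exists_cover_conj_ball (toMatrixHom G) hemb.isInducing a
  have hθ : -Real.log (Real.exp (-(κ * t))) = κ * t := by rw [Real.log_exp, neg_neg]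
  rw [← hθ]
  refine measureEntropy_ge_of_bowen_le hMP hK (Real.exp_pos _) fun Q hQ => ?_
  obtain ⟨V, hV, hVU⟩ := exists_measure_bowen_le a (CosetSpace.isOpenMap_smul_left Γ) (Q := Q)
    (CosetSpace.exists_nhds_injective Γ hQ) (fun s r => tube bm b0 bp s r 0) hκ
    (fun s _ _ h => tube_mono bm b0 bp s h)
    (fun s r hs hr => tube_mem_nhds bm b0 bp ha hs hr)
    (fun V hV => exists_conj_tube_subset bm b0 bp hc hc1 hplus ht hV)
    (fun s hs => exists_mem_tube_of_conj bm b0 bp ha hc hc1 hlam1 hplus ht hs)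
    (fun s r x => measurableSet_image_tube bm b0 bp s r x) ht0 hsupp
    (Measure.support_mem_ae) (lam := l₀) hs₀
    -- All tubes are centred at `u = 0`, where `B⁺_{s'} ⊆ B⁺_s` follows from `s' ≤ s`.
    (fun s s' δ x hs'0 hs's hs hδ0 hδ1 hx => by
      refine hdim s s' δ 0 x hs'0 hs's hs ?_ ?_ hδ0 hδ1 hx
      · rw [mem_supBall_zero_iff, map_zero]
        exact Metric.mem_ball_self (hs'0.trans_le hs's)
      · intro z hz
        exact lt_of_lt_of_le hz hs's)
  refine ⟨V, hV, fun U hU hUo => ?_⟩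
  obtain ⟨C, hC1, hC⟩ := hVU U hU
  have hinv : 1 ≤ (ρ Set.univ)⁻¹ := ENNReal.one_le_inv.2 hρ1
  have hinvtop : (ρ Set.univ)⁻¹ ≠ ∞ := ENNReal.inv_ne_top.2 hpos.ne'
  have hinv' : 1 ≤ (ρ Set.univ)⁻¹.toReal := by
    rw [← ENNReal.toReal_one]
    exact ENNReal.toReal_mono hinvtop hinv
  refine ⟨(ρ Set.univ)⁻¹.toReal * C, one_le_mul_of_one_le_of_one_le hinv' hC1, fun n z hz => ?_⟩
  have hO : IsOpen ((fun g : G => g • z) '' bowenSet a U n) :=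
    CosetSpace.isOpenMap_smul_left Γ z _ (isOpen_bowenSet a hUo n)
  rw [Measure.smul_apply, smul_eq_mul, mul_assoc, ENNReal.ofReal_mul ENNReal.toReal_nonneg,
    ENNReal.ofReal_toReal hinvtop]
  gcongr
  refine hρ.measure_le_of_isOpen hO ENNReal.ofReal_ne_top fun k => ?_
  refine cesaroAverage_apply_le (fun l => ?_) k
  rw [Measure.map_apply (((continuous_const_smul a).iterate l).measurable) hO.measurableSet]
  refine le_trans (le_of_eq ?_) (hC n l z hz)
  congr 1
  ext x
  rw [Set.mem_preimage, smul_iterate]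
  rfl
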